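/- Let $k\ge 2$ and write points of $\mathbb R^k=\mathbb R^2\times\mathbb R^{k-2}$ as $(x,z)$; for $x\in\mathbb R^2\setminus\{0\}$ put $\hat x=x/|x|$, and let $e_1=(1,0)$. For $\nu\in\mathbb R^k$ write $\nu=(\nu_x,\nu_z)$ with $\nu_x\in\mathbb R^2$, $\nu_z\in\mathbb R^{k-2}$, and, at a point $(x,z)$ with $x\neq 0$, $\nu_{x\parallel}=\nu_x-(\hat x\cdot\nu_x)\,\hat x$. For $A\subset\mathbb R^k$, $r>0$ and $z\in\mathbb R^{k-2}$ let $A_{(r,z)}=\{x\in\mathbb R^2\setminus\{0\}:\ |x|=r,\ (x,z)\in A\}$. For a set $E\subset\mathbb R^k$ of locally finite perimeter, let $D\chi_E$ be the distributional derivative of its characteristic function (an $\mathbb R^k$-valued Radon measure) and $|D\chi_E|$ its total variation; the reduced boundary $\partial^*E$ is the set of points $(x,z)$ at which the limit $$\nu^E(x,z)=\lim_{\rho\to0^+}\frac{D\chi_E(B_\rho(x,z))}{|D\chi_E|(B_\rho(x,z))}$$ exists and is a unit vector, and $\nu^E$ is the inner unit normal of $E$. Let $\mu:(0,\infty)\times\mathbb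 R^{k-2}\to[0,\infty)$ be a Lebesgue measurable function with $\mu(r,z)\le 2\pi r$ for almost every $(r,z)$, and suppose that $$F_\mu=\{(x,z)\in(\mathbb R^2\setminus\{0\})\times\mathbb R^{k-2}:\ 2|x|\arccos(\hat x\cdot e_1)<\mu(|x|,z)\}$$ is a set of locally finite perimeter. Then for every (not just almost every) $(r,z)\in(0,\infty)\times\mathbb R^{k-2}$ with $(\partial^*F_\mu)_{(r,z)}\neq\emptyset$, the three functions $$x\mapsto\hat x\cdot\nu^{F_\mu}_x(x,z),\qquad x\mapsto|\nu^{F_\mu}_{x\parallel}(x,z)|,\qquad x\mapsto\nu^{F_\mu}_z(x,z)$$ are constant on $(\partial^*F_\mu)_{(r,z)}$; that is, $x\mapsto\nu^{F_\mu}_{\mathsf c}(x,z)=(\hat x\cdot\nu^{F_\mu}_x,\ |\nu^{F_\mu}_{x\parallel}|,\ \nu^{F_\mu}_z)(x,z)$ is constant on $(\partial^*F_\mu)_{(r,z)}$. -/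

import Mathlib

open MeasureTheory Set Filter Topology
open scoped ENNReal

noncomputable section

namespace CircularSymm

/-! ## Sets of locally finite perimeter, reduced boundary, inner normal in `ℝⁿ` -/

section Perimeter

variable {n : ℕ}

/-- The classical divergence `∑ᵢ ∂ᵢ Tᵢ` of a vector field on `ℝⁿ`. -/
def divergence (T : EuclideanSpace ℝ (Fin n) → EuclideanSpace ℝ (Fin n))
    (p : EuclideanSpace ℝ (Fin n)) : ℝ :=
  ∑ i, (fderiv ℝ T p (EuclideanSpace.single i 1)) i

/-- `T ∈ C¹_c(V; ℝⁿ)`. -/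
structure IsTestField (V : Set (EuclideanSpace ℝ (Fin n)))
    (T : EuclideanSpace ℝ (Fin n) → EuclideanSpace ℝ (Fin n)) : Prop where
  contDiff : ContDiff ℝ 1 T
  hasCompactSupport : HasCompactSupport T
  tsupport_subset : tsupport T ⊆ V

/-- The relative perimeter `P(E; V) ∈ [0, ∞]` of `E` in the open set `V`: the supremum of
`∫_E div T` over the fields `T ∈ C¹_c(V; ℝⁿ)` with `|T| ≤ 1`. The truncation `ENNReal.ofReal`
does not change the supremum, because `T = 0` is admissible. -/
def relPerimeter (E V : Set (EuclideanSpace ℝ (Fin n))) : ℝ≥0∞ :=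
  ⨆ (T : EuclideanSpace ℝ (Fin n) → EuclideanSpace ℝ (Fin n)) (_ : IsTestField V T)
    (_ : ∀ p, ‖T p‖ ≤ 1), ENNReal.ofReal (∫ p in E, divergence T p)

/-- `E ⊆ ℝⁿ` is a set of locally finite perimeter: it is Lebesgue measurable and has finite
perimeter in every open set that is compactly contained in `ℝⁿ`. -/
structure LocallyFinitePerimeter (E : Set (EuclideanSpace ℝ (Fin n))) : Prop where
  nullMeasurableSet : NullMeasurableSet E volume
  relPerimeter_lt_top : ∀ V : Set (EuclideanSpace ℝ (Fin n)), IsOpen V → IsCompact (closure V) →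
    relPerimeter E V < ∞

/-- `Dχ_E = σ τ` is the polar decomposition of the distributional derivative of `χ_E`, that is,
`τ = |Dχ_E|` is a Radon measure, `σ` is a Borel field with `|σ| = 1` `τ`-almost everywhere, and
`∫_E div T = - ∫ T · σ dτ` for all `T ∈ C¹_c(ℝⁿ; ℝⁿ)`. For a set of locally finite
perimeter such a pair exists by the Riesz representation theorem; `τ` is unique and `σ` is unique
up to `τ`-null sets. -/
structure IsPolarDecomposition (E : Set (EuclideanSpace ℝ (Fin n)))
    (τ : Measure (EuclideanSpace ℝ (Fin n)))
    (σ : EuclideanSpace ℝ (Fin n) → EuclideanSpace ℝ (Fin n)) : Prop where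
  isLocallyFinite : IsLocallyFiniteMeasure τ
  measurable : Measurable σ
  norm_eq_one : ∀ᵐ p ∂τ, ‖σ p‖ = 1
  gaussGreen : ∀ T, IsTestField univ T →
    ∫ p in E, divergence T p = - ∫ p, inner ℝ (T p) (σ p) ∂τ

/-- `ν` is a unit vector and `ν = lim_{ρ → 0⁺} Dχ_E(B_ρ(p)) / |Dχ_E|(B_ρ(p))`, where the
denominators are positive. -/
def IsInnerNormalAt (E : Set (EuclideanSpace ℝ (Fin n))) (p ν : EuclideanSpace ℝ (Fin n)) : Prop :=
  ‖ν‖ = 1 ∧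
  ∃ (τ : Measure (EuclideanSpace ℝ (Fin n)))
    (σ : EuclideanSpace ℝ (Fin n) → EuclideanSpace ℝ (Fin n)),
    IsPolarDecomposition E τ σ ∧
    (∀ ρ > 0, 0 < τ (Metric.ball p ρ)) ∧
    Tendsto (fun ρ : ℝ => (τ.real (Metric.ball p ρ))⁻¹ • ∫ q in Metric.ball p ρ, σ q ∂τ)
      (𝓝[>] 0) (𝓝 ν)

/-- The reduced boundary `∂*E`: the points where the limit that defines the inner normal exists
and is a unit vector. -/
def reducedBoundary (E : Set (EuclideanSpace ℝ (Fin n))) : Set (EuclideanSpace ℝ (Fin n)) :=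
  {p | ∃ ν, IsInnerNormalAt E p ν}

open Classical in
/-- The measure-theoretic inner unit normal `ν^E` on `∂*E` (the zero vector elsewhere). It does
not depend on the choice made here, since `|Dχ_E|` is unique and limits are unique. -/
def innerNormal (E : Set (EuclideanSpace ℝ (Fin n))) (p : EuclideanSpace ℝ (Fin n)) :
    EuclideanSpace ℝ (Fin n) :=
  if h : ∃ ν, IsInnerNormalAt E p ν then h.choose else 0

theorem isInnerNormalAt_innerNormal {E : Set (EuclideanSpace ℝ (Fin n))}
    {p : EuclideanSpace ℝ (Fin n)} (hp : p ∈ reducedBoundary E) :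
    IsInnerNormalAt E p (innerNormal E p) := by
  have h : ∃ ν, IsInnerNormalAt E p ν := hp
  rw [innerNormal, dif_pos h]
  exact h.choose_spec

end Perimeter

/-! ## The decomposition `ℝᵏ = ℝ² × ℝᵏ⁻²`, with `k = 2 + m` -/

variable {m : ℕ}

/-- The point `(x, z) ∈ ℝ² × ℝᵐ = ℝ²⁺ᵐ`. -/
def joinXZ (x : EuclideanSpace ℝ (Fin 2)) (z : EuclideanSpace ℝ (Fin m)) :
    EuclideanSpace ℝ (Fin (2 + m)) :=
  WithLp.toLp 2 (Fin.append x.ofLp z.ofLp)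

/-- The first two coordinates `p_x` of `p ∈ ℝ²⁺ᵐ`. -/
def xPart (p : EuclideanSpace ℝ (Fin (2 + m))) : EuclideanSpace ℝ (Fin 2) :=
  WithLp.toLp 2 fun i => p (Fin.castAdd m i)

/-- The last `m` coordinates `p_z` of `p ∈ ℝ²⁺ᵐ`. -/
def zPart (p : EuclideanSpace ℝ (Fin (2 + m))) : EuclideanSpace ℝ (Fin m) :=
  WithLp.toLp 2 fun j => p (Fin.natAdd 2 j)

theorem xPart_joinXZ (x : EuclideanSpace ℝ (Fin 2)) (z : EuclideanSpace ℝ (Fin m)) :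
    xPart (joinXZ x z) = x := by
  ext i
  simp [xPart, joinXZ]

theorem zPart_joinXZ (x : EuclideanSpace ℝ (Fin 2)) (z : EuclideanSpace ℝ (Fin m)) :
    zPart (joinXZ x z) = z := by
  ext i
  simp [zPart, joinXZ]

/-- The direction `x̂ = x / |x|` of `x ∈ ℝ² \ {0}`. -/
def hat (x : EuclideanSpace ℝ (Fin 2)) : EuclideanSpace ℝ (Fin 2) :=
  ‖x‖⁻¹ • x

/-- The circular slice `E_{(r, z)} = {x ∈ ℝ² \ {0} : |x| = r, (x, z) ∈ E}`. -/
def slice (E : Set (EuclideanSpace ℝ (Fin (2 + m)))) (r : ℝ) (z : EuclideanSpace ℝ (Fin m)) :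
    Set (EuclideanSpace ℝ (Fin 2)) :=
  {x | x ≠ 0 ∧ ‖x‖ = r ∧ joinXZ x z ∈ E}

/-- The domain `(0, ∞) × ℝᵐ` of the function `μ`. -/
def halfSpace (m : ℕ) : Set (ℝ × EuclideanSpace ℝ (Fin m)) :=
  Ioi 0 ×ˢ univ

/-- The circularly symmetric set
`F_μ = {(x, z) : x ≠ 0, 2 |x| arccos (x̂ · e₁) < μ(|x|, z)}`. Only the values of `μ` on
`(0, ∞) × ℝᵐ` matter. -/
def symmSet (μ : ℝ × EuclideanSpace ℝ (Fin m) → ℝ) : Set (EuclideanSpace ℝ (Fin (2 + m))) :=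
  {p | xPart p ≠ 0 ∧
    2 * ‖xPart p‖ * Real.arccos (inner ℝ (hat (xPart p)) (EuclideanSpace.single 0 1)) <
      μ (‖xPart p‖, zPart p)}

/-- The component `ν_{x∥} = ν_x - (x̂ · ν_x) x̂` of `ν_x` tangential to the circle through `x`. -/
def tangential (x : EuclideanSpace ℝ (Fin 2)) (ν : EuclideanSpace ℝ (Fin (2 + m))) :
    EuclideanSpace ℝ (Fin 2) :=
  xPart ν - inner ℝ (hat x) (xPart ν) • hat x

/-- The vector `ν^E_c(x, z) = (x̂ · ν^E_x, |ν^E_{x∥}|, ν^E_z) ∈ ℝ²⁺ᵐ`, with `ν^E` taken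
at `(x, z)`. -/
def circularNormal (E : Set (EuclideanSpace ℝ (Fin (2 + m)))) (x : EuclideanSpace ℝ (Fin 2))
    (z : EuclideanSpace ℝ (Fin m)) : EuclideanSpace ℝ (Fin (2 + m)) :=
  joinXZ !₂[inner ℝ (hat x) (xPart (innerNormal E (joinXZ x z))),
      ‖tangential x (innerNormal E (joinXZ x z))‖]
    (zPart (innerNormal E (joinXZ x z)))

end CircularSymm

end

open CircularSymm

/-!
The set `F = symmSet μ` has the following monotonicity. Let `x ≠ y` be points of the plane with
`|x| = |y|` and `⟨y, e₁⟩ ≤ ⟨x, e₁⟩`, and let `O` be the reflection of `ℝ² × ℝᵐ` that fixes `z` and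
exchanges `x` and `y`. Near `(y, z)` the reflection `O` does not decrease `⟨·, e₁⟩`, hence it maps
`F` into `F` (`eventually_reflectX_mem_symmSet`). If `(x, z)` and `(y, z)` are both in the reduced
boundary, then blowing up at these points turns the inclusion `O F ⊆ F` into an inclusion of half
spaces, so `O` maps the inner normal at `(y, z)` to the one at `(x, z)`
(`IsInnerNormalAt.map_eq_of_eventually_mapsTo`). The radial component, the length of the
tangential component and the `z` component of a normal are invariant under `O`.

The part of De Giorgi's blow-up theorem that is used is
`IsInnerNormalAt.eventually_measureReal_diff_le`: if `b` is the inner normal of `E` at `p`, then `E`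
fills `{y ∈ B_ρ(p) : ⟨y - p, b⟩ > δ ρ}` up to measure `o(ρⁿ)`. It is applied to `F` at one point and
to the complement of `F` at the other. The proof uses neither compactness in `BV` nor an
isoperimetric inequality, and rests on almost-invariance under translations:

* Let `σ τ` be the polar decomposition of `Dχ_E`, with `σ` close to `b` on average on the balls
  `B_ρ(p)`. Testing with radially decreasing cutoffs, whose superlevel sets are balls, bounds
  `τ(B_s)` by `C / t` times `|E ∩ B_{s+t}|` (`exists_measureReal_ball_le`).
* For `⟨w, b⟩ ≥ 0`, the set of `x ∈ E ∩ B_s` with `x + w ∉ E` has measure at most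
  `|w| ∫ |σ - b| dτ`, the integral being over `B_{s+|w|}`
  (`IsPolarDecomposition.measure_translate_diff_le`). With `|w| ≤ t` and the previous bound, this is
  a small multiple of `|E ∩ B_{s+2t}|`, whatever the size of `t` (`NearlyConstantNormal`).
* Averaging over all `w` in the half ball `{|w| < t, ⟨w, b⟩ > 0}` produces a point `x ∈ E ∩ B_s` for
  which `E` fills most of the half ball with vertex `x`. Applied on dyadic scales this yields
  `|E ∩ B_R| ≥ c Rⁿ` (`NearlyConstantNormal.density_lower_bound`). Applied once more with `s = δ ρ`
  and `t = 2 ρ`, it yields the blow-up statement.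
-/

namespace CircularSymm

section Perimeter

variable {n : ℕ} {E : Set (EuclideanSpace ℝ (Fin n))} {τ : Measure (EuclideanSpace ℝ (Fin n))}
  {σ : EuclideanSpace ℝ (Fin n) → EuclideanSpace ℝ (Fin n)}

/-! ### The Gauss-Green formula for scalar test functions, and complements -/

theorem divergence_smul_const {φ : EuclideanSpace ℝ (Fin n) → ℝ} (hφ : ContDiff ℝ 1 φ)
    (w p : EuclideanSpace ℝ (Fin n)) :
    divergence (fun q => φ q • w) p = fderiv ℝ φ p w := by
  have hd : HasFDerivAt (fun q => φ q • w) ((fderiv ℝ φ p).smulRight w) p :=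
    ((hφ.differentiable one_ne_zero) p).hasFDerivAt.smul_const w
  have hw : w = ∑ i, w i • EuclideanSpace.single i (1 : ℝ) := by
    ext j
    simp [Finset.sum_apply, Pi.single_apply]
  rw [divergence, hd.fderiv]
  conv_rhs => rw [hw, map_sum]
  refine Finset.sum_congr rfl fun i _ => ?_
  simp [mul_comm]

theorem isTestField_smul_const {φ : EuclideanSpace ℝ (Fin n) → ℝ} (hφ : ContDiff ℝ 1 φ)
    (hc : HasCompactSupport φ) (w : EuclideanSpace ℝ (Fin n)) :
    IsTestField univ fun q => φ q • w :=
  ⟨hφ.smul contDiff_const, hc.smul_right, subset_univ _⟩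

/-- The Gauss-Green formula for the field `φ w`, with `w` a constant vector. -/
theorem IsPolarDecomposition.setIntegral_fderiv (h : IsPolarDecomposition E τ σ)
    {φ : EuclideanSpace ℝ (Fin n) → ℝ} (hφ : ContDiff ℝ 1 φ) (hc : HasCompactSupport φ)
    (w : EuclideanSpace ℝ (Fin n)) :
    ∫ p in E, fderiv ℝ φ p w = - ∫ p, φ p * inner ℝ w (σ p) ∂τ := by
  have := h.gaussGreen _ (isTestField_smul_const hφ hc w)
  simpa only [divergence_smul_const hφ, real_inner_smul_left] using this

theorem integral_divergence_eq_zero {T : EuclideanSpace ℝ (Fin n) → EuclideanSpace ℝ (Fin n)}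
    (hT : IsTestField univ T) :
    Integrable (divergence T) ∧ ∫ p, divergence T p = 0 := by
  have hcont : Continuous (fderiv ℝ T) := hT.contDiff.continuous_fderiv one_ne_zero
  have hcomp : HasCompactSupport (fderiv ℝ T) := hT.hasCompactSupport.fderiv ℝ
  have hint : ∀ v, Integrable fun p => fderiv ℝ T p v := fun v =>
    (hcont.clm_apply continuous_const).integrable_of_hasCompactSupport
      (hcomp.comp_left (g := fun L : _ →L[ℝ] EuclideanSpace ℝ (Fin n) => L v) (by simp))
  have key : ∀ v, ∫ p, fderiv ℝ T p v = 0 := by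
    intro v
    have hTint := hT.contDiff.continuous.integrable_of_hasCompactSupport (μ := volume)
      hT.hasCompactSupport
    have := integral_smul_fderiv_eq_neg_fderiv_smul_of_integrable (μ := volume)
      (f := fun _ : EuclideanSpace ℝ (Fin n) => (1 : ℝ)) (g := T) (v := v)
      (by simp) (by simpa using hint v) (by simpa using hTint)
      (fun _ _ => differentiableAt_const _)
      (fun x _ => hT.contDiff.differentiable one_ne_zero x)
    simpa using this
  have hint' : ∀ i : Fin n, Integrable fun p =>
      (fderiv ℝ T p (EuclideanSpace.single i 1)) i := fun i =>
    (EuclideanSpace.proj i : EuclideanSpace ℝ (Fin n) →L[ℝ] ℝ).integrable_comp (hint _)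
  refine ⟨integrable_finsetSum _ fun i _ => hint' i, ?_⟩
  simp only [divergence]
  rw [integral_finsetSum _ fun i _ => hint' i]
  refine Finset.sum_eq_zero fun i _ => ?_
  have := (EuclideanSpace.proj i : EuclideanSpace ℝ (Fin n) →L[ℝ] ℝ).integral_comp_comm
    (hint (EuclideanSpace.single i 1))
  rw [key] at this
  simpa using this

/-- Passing to the complement reverses the normal, since the divergence of a test field has
integral zero over the whole space. -/
theorem IsPolarDecomposition.compl (h : IsPolarDecomposition E τ σ)
    (hE : NullMeasurableSet E volume) : IsPolarDecomposition Eᶜ τ (fun q => -σ q) where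
  isLocallyFinite := h.isLocallyFinite
  measurable := h.measurable.neg
  norm_eq_one := by simpa using h.norm_eq_one
  gaussGreen T hT := by
    obtain ⟨hint, h0⟩ := integral_divergence_eq_zero hT
    have := integral_add_compl₀ hE hint
    rw [h0, h.gaussGreen T hT] at this
    simp only [inner_neg_right, integral_neg]
    linarith

theorem IsPolarDecomposition.congr {E' : Set (EuclideanSpace ℝ (Fin n))}
    (h : IsPolarDecomposition E τ σ) (hE : E =ᵐ[volume] E') : IsPolarDecomposition E' τ σ where
  isLocallyFinite := h.isLocallyFinite
  measurable := h.measurable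
  norm_eq_one := h.norm_eq_one
  gaussGreen T hT := by rw [← setIntegral_congr_set hE, h.gaussGreen T hT]

theorem IsInnerNormalAt.compl {p ν : EuclideanSpace ℝ (Fin n)} (h : IsInnerNormalAt E p ν)
    (hE : NullMeasurableSet E volume) : IsInnerNormalAt Eᶜ p (-ν) := by
  obtain ⟨h1, τ, σ, hp, hpos, hlim⟩ := h
  refine ⟨by simpa using h1, τ, _, hp.compl hE, hpos, ?_⟩
  simpa only [integral_neg, smul_neg] using hlim.neg

theorem IsInnerNormalAt.congr {E' : Set (EuclideanSpace ℝ (Fin n))}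
    {p ν : EuclideanSpace ℝ (Fin n)} (h : IsInnerNormalAt E p ν) (hE : E =ᵐ[volume] E') :
    IsInnerNormalAt E' p ν := by
  obtain ⟨h1, τ, σ, hp, hpos, hlim⟩ := h
  exact ⟨h1, τ, σ, hp.congr hE, hpos, hlim⟩

/-! ### Almost-monotonicity under translations -/

theorem IsPolarDecomposition.integrableOn_norm_sub (h : IsPolarDecomposition E τ σ)
    (b : EuclideanSpace ℝ (Fin n)) {s : Set (EuclideanSpace ℝ (Fin n))} (hs : Bornology.IsBounded s) :
    IntegrableOn (fun q => ‖σ q - b‖) s τ := by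
  have := h.isLocallyFinite
  refine Measure.integrableOn_of_bounded (M := 1 + ‖b‖) hs.measure_lt_top.ne
    (h.measurable.sub_const b).norm.aestronglyMeasurable ?_
  filter_upwards [ae_restrict_of_ae h.norm_eq_one] with q hq
  rw [norm_norm, ← hq]
  exact norm_sub_le _ _

/-- Differentiation of `θ ↦ ∫_E φ(x - θ w) dx` under the integral sign. -/
theorem hasDerivAt_setIntegral_translate {φ : EuclideanSpace ℝ (Fin n) → ℝ}
    (hφ : ContDiff ℝ 1 φ) (hc : HasCompactSupport φ) (w : EuclideanSpace ℝ (Fin n)) (θ : ℝ) :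
    HasDerivAt (fun θ : ℝ => ∫ x in E, φ (x - θ • w))
      (- ∫ x in E, fderiv ℝ φ (x - θ • w) w) θ := by
  have hcd : Continuous (fderiv ℝ φ) := hφ.continuous_fderiv one_ne_zero
  have hcs : HasCompactSupport (fderiv ℝ φ) := hc.fderiv ℝ
  obtain ⟨M, hM⟩ := hcs.exists_bound_of_continuous hcd
  obtain ⟨R, hR⟩ := hcs.isCompact.isBounded.subset_closedBall 0
  have htr : ∀ θ : ℝ, Integrable (fun x => φ (x - θ • w)) := fun θ =>
    (hφ.continuous.integrable_of_hasCompactSupport hc).comp_sub_right (θ • w)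
  set B : Set (EuclideanSpace ℝ (Fin n)) := Metric.closedBall 0 (R + (|θ| + 1) * ‖w‖)
  rw [← integral_neg]
  refine (hasDerivAt_integral_of_dominated_loc_of_deriv_le (μ := volume.restrict E)
    (F := fun (θ : ℝ) x => φ (x - θ • w))
    (F' := fun (θ : ℝ) x => -(fderiv ℝ φ (x - θ • w) w))
    (bound := B.indicator fun _ => M * ‖w‖)
    (Metric.ball_mem_nhds θ one_pos) (Eventually.of_forall fun θ => ?_) ?_ ?_ ?_ ?_ ?_).2
  · exact (htr θ).aestronglyMeasurable.restrict
  · exact (htr θ).restrict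
  · exact Continuous.aestronglyMeasurable (by fun_prop)
  · refine Eventually.of_forall fun x θ' hθ' => ?_
    by_cases hx : x ∈ B
    · rw [indicator_of_mem hx, norm_neg]
      exact (ContinuousLinearMap.le_opNorm _ _).trans
        (mul_le_mul_of_nonneg_right (hM _) (norm_nonneg _))
    · rw [indicator_of_notMem hx]
      have : fderiv ℝ φ (x - θ' • w) = 0 := by
        by_contra hne
        have h1 : x - θ' • w ∈ Metric.closedBall (0 : EuclideanSpace ℝ (Fin n)) R :=
          hR (subset_tsupport _ hne)
        rw [mem_closedBall_zero_iff] at h1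
        apply hx
        rw [mem_closedBall_zero_iff]
        have h2 : |θ'| ≤ |θ| + 1 := by
          rw [Metric.mem_ball, Real.dist_eq] at hθ'
          have := abs_sub_abs_le_abs_sub θ' θ
          linarith
        calc ‖x‖ = ‖(x - θ' • w) + θ' • w‖ := by simp
          _ ≤ ‖x - θ' • w‖ + |θ'| * ‖w‖ := by
            rw [← Real.norm_eq_abs, ← norm_smul]; exact norm_add_le _ _
          _ ≤ _ := by gcongr
      simp [this]
  · refine Integrable.restrict ?_
    rw [integrable_indicator_iff Metric.isClosed_closedBall.measurableSet]
    exact integrableOn_const (isCompact_closedBall _ _).measure_lt_top.ne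
  · refine Eventually.of_forall fun x θ' _ => ?_
    have h1 : HasDerivAt (fun θ : ℝ => x - θ • w) (-w) θ' := by
      simpa using ((hasDerivAt_id θ').smul_const w).const_sub x
    have h2 := (hφ.differentiable one_ne_zero (x - θ' • w)).hasFDerivAt.comp_hasDerivAt θ' h1
    simpa [Function.comp_def] using h2

/-- The smooth form of `measure_translate_diff_le`. The derivative of `θ ↦ ∫_E φ(x - θ w) dx` is
`∫ φ(q - θ w) ⟨w, σ q⟩ dτ(q)`, and `⟨w, σ⟩ ≥ ⟨w, σ - b⟩ ≥ -|w| |σ - b|` as `⟨w, b⟩ ≥ 0`. -/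
theorem IsPolarDecomposition.setIntegral_sub_translate_le (h : IsPolarDecomposition E τ σ)
    {b w p : EuclideanSpace ℝ (Fin n)} (hw : 0 ≤ inner ℝ w b) {s : ℝ}
    {φ : EuclideanSpace ℝ (Fin n) → ℝ}
    (hφ : ContDiff ℝ 1 φ) (hφ0 : ∀ x, 0 ≤ φ x) (hφ1 : ∀ x, φ x ≤ 1)
    (hs : Function.support φ ⊆ Metric.ball p s) :
    (∫ x in E, φ x) - ∫ x in E, φ (x - w) ≤
      ‖w‖ * ∫ q in Metric.ball p (s + ‖w‖), ‖σ q - b‖ ∂τ := by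
  have := h.isLocallyFinite
  have hc : HasCompactSupport φ := HasCompactSupport.of_support_subset_isCompact
    (isCompact_closedBall p s) (hs.trans Metric.ball_subset_closedBall)
  set g : ℝ → ℝ := fun θ => ∫ x in E, φ (x - θ • w)
  set L := ‖w‖ * ∫ q in Metric.ball p (s + ‖w‖), ‖σ q - b‖ ∂τ
  have hg : ∀ θ, HasDerivAt g (- ∫ x in E, fderiv ℝ φ (x - θ • w) w) θ :=
    hasDerivAt_setIntegral_translate hφ hc w
  have hb : ∀ θ ∈ Icc (0 : ℝ) 1, -L ≤ deriv g θ := by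
    intro θ hθ
    rw [(hg θ).deriv]
    have hφθ : ContDiff ℝ 1 fun x => φ (x - θ • w) := hφ.comp (contDiff_id.sub contDiff_const)
    have hcθ : HasCompactSupport fun x => φ (x - θ • w) :=
      hc.comp_homeomorph (Homeomorph.subRight (θ • w))
    have h1 := h.setIntegral_fderiv hφθ hcθ w
    have e : ∀ x, fderiv ℝ (fun x => φ (x - θ • w)) x = fderiv ℝ φ (x - θ • w) := fun x => by
      simpa only [sub_eq_add_neg] using fderiv_comp_add_right (𝕜 := ℝ) (f := φ) (x := x) (-(θ • w))
    simp only [e] at h1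
    rw [h1, neg_neg]
    have hI : IntegrableOn (fun q => ‖w‖ * ‖σ q - b‖) (Metric.ball p (s + ‖w‖)) τ :=
      (h.integrableOn_norm_sub b Metric.isBounded_ball).const_mul _
    change -(‖w‖ * ∫ q in Metric.ball p (s + ‖w‖), ‖σ q - b‖ ∂τ) ≤ _
    rw [← integral_const_mul, ← integral_indicator Metric.isOpen_ball.measurableSet,
      ← integral_neg]
    refine integral_mono_ae (hI.integrable_indicator Metric.isOpen_ball.measurableSet).neg ?_ ?_
    · have hi : Integrable (fun q => φ (q - θ • w)) τ :=
        hφθ.continuous.integrable_of_hasCompactSupport hcθ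
      refine hi.mul_bdd (c := ‖w‖) (measurable_const.inner h.measurable).aestronglyMeasurable ?_
      filter_upwards [h.norm_eq_one] with q hq
      simpa [hq] using norm_inner_le_norm (𝕜 := ℝ) w (σ q)
    · refine Eventually.of_forall fun q => ?_
      have h2 : -(‖w‖ * ‖σ q - b‖) ≤ inner ℝ w (σ q) := by
        have e : inner ℝ w (σ q) = inner ℝ w (σ q - b) + inner ℝ w b := by
          rw [inner_sub_right]; ring
        have := neg_le_of_abs_le (abs_real_inner_le_norm w (σ q - b))
        linarith
      have h3 : 0 ≤ ‖w‖ * ‖σ q - b‖ := by positivity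
      by_cases hq : q ∈ Metric.ball p (s + ‖w‖)
      · simp only [indicator_of_mem hq]
        nlinarith [hφ0 (q - θ • w), hφ1 (q - θ • w),
          mul_le_mul_of_nonneg_left h2 (hφ0 (q - θ • w)),
          mul_le_mul_of_nonneg_right (hφ1 (q - θ • w)) h3]
      · have : φ (q - θ • w) = 0 := by
          by_contra hne
          have h4 := hs hne
          rw [Metric.mem_ball, dist_eq_norm] at h4 hq
          apply hq
          calc ‖q - p‖ = ‖(q - θ • w - p) + θ • w‖ := by congr 1; abel
            _ ≤ ‖q - θ • w - p‖ + |θ| * ‖w‖ := by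
              rw [← Real.norm_eq_abs, ← norm_smul]; exact norm_add_le _ _
            _ < s + 1 * ‖w‖ := by
              refine add_lt_add_of_lt_of_le h4 ?_
              gcongr
              rw [abs_of_nonneg hθ.1]; exact hθ.2
            _ = _ := by ring
        simp [indicator_of_notMem hq, this]
  have := (convex_Icc (0 : ℝ) 1).mul_sub_le_image_sub_of_le_deriv (f := g) (C := -L)
    (fun θ _ => (hg θ).continuousAt.continuousWithinAt)
    (fun θ _ => (hg θ).differentiableAt.differentiableWithinAt)
    (fun θ hθ => hb θ (interior_subset hθ)) 0 (by simp) 1 (by simp) zero_le_one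
  simp only [g, zero_smul, one_smul, sub_zero, mul_one] at this
  linarith

theorem exists_contDiff_bump {K U : Set (EuclideanSpace ℝ (Fin n))} (hK : IsClosed K)
    (hU : IsOpen U) (hKU : K ⊆ U) : ∃ φ : EuclideanSpace ℝ (Fin n) → ℝ, ContDiff ℝ 1 φ ∧
      (∀ x, 0 ≤ φ x) ∧ (∀ x, φ x ≤ 1) ∧ Function.support φ = U ∧ ∀ x ∈ K, φ x = 1 := by
  obtain ⟨f, hf, hr, hs, h1⟩ := exists_contMDiff_support_eq_eq_one_iff
    (n := 1) (modelWithCornersSelf ℝ (EuclideanSpace ℝ (Fin n))) hU hK hKU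
  exact ⟨f, hf.contDiff, fun x => (hr ⟨x, rfl⟩).1, fun x => (hr ⟨x, rfl⟩).2, hs,
    fun x hx => (h1 x).1 hx⟩

/-- If `⟨w, b⟩ ≥ 0`, then translation by `w` moves few points of `E` out of `E`, provided that the
normal `σ` is close to `b`. -/
theorem IsPolarDecomposition.measure_translate_diff_le (h : IsPolarDecomposition E τ σ)
    (hE : MeasurableSet E)
    {b w p : EuclideanSpace ℝ (Fin n)} (hw : 0 ≤ inner ℝ w b) (s : ℝ) :
    volume.real {x | x ∈ E ∩ Metric.ball p s ∧ x + w ∉ E} ≤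
      ‖w‖ * ∫ q in Metric.ball p (s + ‖w‖), ‖σ q - b‖ ∂τ := by
  set A := {x | x ∈ E ∩ Metric.ball p s ∧ x + w ∉ E} with hAdef
  set E' := (fun x => x + w) ⁻¹' E with hE'def
  have hE' : MeasurableSet E' := (measurable_add_const w) hE
  have hA : MeasurableSet A := (hE.inter Metric.isOpen_ball.measurableSet).inter hE'.compl
  have hAs : A ⊆ Metric.ball p s := fun x hx => hx.1.2
  have hAfin : volume A ≠ ∞ := 
    ((measure_mono hAs).trans_lt (measure_ball_lt_top (μ := volume) (x := p) (r := s))).ne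
  refine le_of_forall_pos_le_add fun ε hε => ?_
  -- A test function `φ` that approximates the characteristic function of `A` in `L¹`.
  have hε2 : ENNReal.ofReal (ε / 2) ≠ 0 := by simpa using hε
  obtain ⟨K, hKA, hK, hKv⟩ := hA.exists_isCompact_lt_add hAfin hε2
  obtain ⟨U, hKU, hU, hUv⟩ := K.exists_isOpen_lt_add (μ := volume) hK.measure_lt_top.ne hε2
  set V := U ∩ Metric.ball p s
  have hV : IsOpen V := hU.inter Metric.isOpen_ball
  have hKV : K ⊆ V := subset_inter hKU (hKA.trans hAs)
  obtain ⟨φ, hφ, hφ0, hφ1, hφs, hφK⟩ := exists_contDiff_bump hK.isClosed hV hKV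
  have hmain := h.setIntegral_sub_translate_le hw hφ hφ0 hφ1
    (hφs.subset.trans inter_subset_right)
  have hc : HasCompactSupport φ := HasCompactSupport.of_support_subset_isCompact
    (isCompact_closedBall p s)
    ((hφs.subset.trans inter_subset_right).trans Metric.ball_subset_closedBall)
  have hi : Integrable φ := hφ.continuous.integrable_of_hasCompactSupport hc
  have htr : ∫ x in E, φ (x - w) = ∫ x in E', φ x := by
    rw [← integral_indicator hE, ← integral_indicator hE',
      ← integral_add_right_eq_self _ w]
    congr 1
    ext x
    simp only [indicator, add_sub_cancel_right]
    rfl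
  have hKfin := hK.measure_lt_top (μ := volume)
  have hVfin : volume V < ∞ := 
    (measure_mono inter_subset_right).trans_lt (measure_ball_lt_top (x := p) (r := s))
  have hdiff : volume.real K - volume.real (V \ K) ≤ (∫ x in E, φ x) - ∫ x in E', φ x := by
    have hVK : MeasurableSet (V \ K) := hV.measurableSet.diff hK.measurableSet
    have i1 : Integrable (K.indicator fun _ => (1 : ℝ)) volume :=
      (integrable_indicator_iff hK.measurableSet).2 (integrableOn_const hKfin.ne)
    have i2 : Integrable ((V \ K).indicator fun _ => (1 : ℝ)) volume :=
      (integrable_indicator_iff hVK).2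
        (integrableOn_const ((measure_mono sdiff_subset).trans_lt hVfin).ne)
    have e1 : volume.real K = ∫ x, K.indicator (fun _ => (1 : ℝ)) x := by
      rw [integral_indicator hK.measurableSet]; simp
    have e2 : volume.real (V \ K) = ∫ x, (V \ K).indicator (fun _ => (1 : ℝ)) x := by
      rw [integral_indicator hVK]; simp
    rw [← integral_indicator hE, ← integral_indicator hE', e1, e2, ← integral_sub i1 i2,
      ← integral_sub (hi.indicator hE) (hi.indicator hE')]
    refine integral_mono (i1.sub i2) ((hi.indicator hE).sub (hi.indicator hE')) fun x => ?_
    have h0 := hφ0 x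
    have h1 := hφ1 x
    by_cases hxK : x ∈ K
    · have hxA := hKA hxK
      have hxE : x ∈ E := hxA.1.1
      have hxE' : x ∉ E' := hxA.2
      simp [hxK, hxE, hxE', hφK x hxK]
    · by_cases hxV : x ∈ V
      · have : (0 : ℝ) ≤ E.indicator φ x := indicator_nonneg (fun x _ => hφ0 x) x
        have h2 : E'.indicator φ x ≤ φ x := indicator_le_self' (fun x _ => hφ0 x) x
        simp only [hxK, hxV, indicator_of_mem, Set.mem_sdiff, not_false_eq_true, and_self,
          indicator_of_notMem]
        linarith
      · have : φ x = 0 := by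
          rw [← Function.notMem_support, hφs]; exact hxV
        simp [indicator, this, hxK, hxV]
  have hVK : volume.real (V \ K) ≤ ε / 2 := by
    rw [measureReal_sdiff hKV hK.measurableSet hVfin.ne]
    have : volume.real V ≤ volume.real K + ε / 2 := by
      have h1 : volume V ≤ volume K + ENNReal.ofReal (ε / 2) :=
        (measure_mono inter_subset_left).trans hUv.le
      have h2 := ENNReal.toReal_mono (by finiteness) h1
      rwa [ENNReal.toReal_add hKfin.ne ENNReal.ofReal_ne_top,
        ENNReal.toReal_ofReal (by positivity)] at h2
    linarith
  have hAK : volume.real A ≤ volume.real K + ε / 2 := by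
    have h2 := ENNReal.toReal_mono (by finiteness) hKv.le
    rwa [ENNReal.toReal_add hKfin.ne ENNReal.ofReal_ne_top,
        ENNReal.toReal_ofReal (by positivity)] at h2
  linarith

/-! ### Upper bound for the perimeter in small balls -/

theorem IsPolarDecomposition.integrableOn_normal (h : IsPolarDecomposition E τ σ)
    {s : Set (EuclideanSpace ℝ (Fin n))} (hs : Bornology.IsBounded s) : IntegrableOn σ s τ := by
  have := h.isLocallyFinite
  refine Measure.integrableOn_of_bounded (M := 1) hs.measure_lt_top.ne
    h.measurable.aestronglyMeasurable ?_
  filter_upwards [ae_restrict_of_ae h.norm_eq_one] with q hq using hq.le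

/-- Convergence of the averages of `σ` to the unit vector `b` forces `σ` to be close to `b` in
mean, because `|σ - b|² = 2 (1 - ⟨b, σ⟩)`. -/
theorem IsPolarDecomposition.exists_integral_norm_sub_le (h : IsPolarDecomposition E τ σ)
    {b p : EuclideanSpace ℝ (Fin n)} (hb : ‖b‖ = 1)
    (hpos : ∀ ρ > 0, 0 < τ (Metric.ball p ρ))
    (hlim : Tendsto (fun ρ : ℝ => (τ.real (Metric.ball p ρ))⁻¹ • ∫ q in Metric.ball p ρ, σ q ∂τ)
      (𝓝[>] 0) (𝓝 b)) {η : ℝ} (hη : 0 < η) :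
    ∃ ρ₀ > 0, ∀ ρ, 0 < ρ → ρ ≤ ρ₀ →
      ∫ q in Metric.ball p ρ, ‖σ q - b‖ ∂τ ≤ η * τ.real (Metric.ball p ρ) := by
  have := h.isLocallyFinite
  have hlim' := (tendsto_const_nhds (x := b)).inner (𝕜 := ℝ) hlim
  rw [real_inner_self_eq_norm_sq, hb, one_pow] at hlim'
  have hev : ∀ᶠ ρ in 𝓝[>] (0 : ℝ), 1 - η ^ 2 / 2 <
      inner ℝ b ((τ.real (Metric.ball p ρ))⁻¹ • ∫ q in Metric.ball p ρ, σ q ∂τ) :=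
    hlim'.eventually (lt_mem_nhds (by have := pow_pos hη 2; linarith))
  obtain ⟨u, hu, hu'⟩ := mem_nhdsGT_iff_exists_Ioc_subset.1 hev
  refine ⟨u, hu, fun ρ h0 h1 => ?_⟩
  have hρ := hu' ⟨h0, h1⟩
  simp only [mem_ofPred_eq, inner_smul_right] at hρ
  set B := Metric.ball p ρ
  have hτ : 0 < τ.real B :=
    ENNReal.toReal_pos (hpos ρ h0).ne' (measure_ball_lt_top (μ := τ)).ne
  have hBb : Bornology.IsBounded B := Metric.isBounded_ball
  have hσ := h.integrableOn_normal hBb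
  have i1 : IntegrableOn (fun q => inner ℝ b (σ q)) B τ := hσ.const_inner b
  have hc : ∀ c : ℝ, IntegrableOn (fun _ => c) B τ := fun c =>
    integrableOn_const hBb.measure_lt_top.ne
  have i2 : IntegrableOn (fun q => (1 - inner ℝ b (σ q)) / η) B τ := ((hc 1).sub i1).div_const η
  have hle : ∫ q in B, ‖σ q - b‖ ∂τ ≤ ∫ q in B, (η / 2 + (1 - inner ℝ b (σ q)) / η) ∂τ := by
    refine integral_mono_ae (h.integrableOn_norm_sub b hBb) ((hc _).add i2) ?_
    filter_upwards [ae_restrict_of_ae h.norm_eq_one] with q hq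
    have e : ‖σ q - b‖ ^ 2 = 2 * (1 - inner ℝ b (σ q)) := by
      rw [norm_sub_sq_real, hq, hb, real_inner_comm]; ring
    have e2 : (1 - inner ℝ b (σ q)) / η = ‖σ q - b‖ ^ 2 / (2 * η) := by
      rw [e]; field_simp
    -- Young's inequality, weighted so that both terms contribute `η / 2` after integration.
    rw [e2, ← sub_nonneg]
    have : η / 2 + ‖σ q - b‖ ^ 2 / (2 * η) - ‖σ q - b‖ = (‖σ q - b‖ - η) ^ 2 / (2 * η) := by
      field_simp; ring
    rw [this]; positivity
  refine hle.trans ?_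
  rw [integral_add (hc _) i2, integral_div, integral_div,
    integral_sub (hc 1) i1, integral_inner hσ]
  simp only [setIntegral_const, smul_eq_mul, mul_one]
  have h3 : τ.real B - inner ℝ b (∫ q in B, σ q ∂τ) ≤ τ.real B * (η ^ 2 / 2) := by
    have := mul_lt_mul_of_pos_left hρ hτ
    rw [mul_inv_cancel_left₀ hτ.ne'] at this
    linarith
  have h4 : (τ.real B - inner ℝ b (∫ q in B, σ q ∂τ)) / η ≤ τ.real B * (η / 2) := by
    rw [div_le_iff₀ hη]; linarith
  linarith

theorem exists_lipschitz_smoothTransition :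
    ∃ C : NNReal, 0 < C ∧ LipschitzWith C Real.smoothTransition := by
  have hd : ContDiff ℝ 1 Real.smoothTransition := Real.smoothTransition.contDiff
  have hcont : Continuous (deriv Real.smoothTransition) := hd.continuous_deriv le_rfl
  have hcs : HasCompactSupport (deriv Real.smoothTransition) := by
    refine HasCompactSupport.of_support_subset_isCompact (isCompact_Icc (a := (0 : ℝ)) (b := 1)) ?_
    intro x hx
    by_contra hne
    apply hx
    rcases not_and_or.1 hne with h | h
    · have : Real.smoothTransition =ᶠ[𝓝 x] fun _ => 0 := by
        filter_upwards [gt_mem_nhds (not_le.1 h)] with y hy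
        exact Real.smoothTransition.zero_of_nonpos hy.le
      rw [this.deriv_eq, deriv_const]
    · have : Real.smoothTransition =ᶠ[𝓝 x] fun _ => 1 := by
        filter_upwards [lt_mem_nhds (not_le.1 h)] with y hy
        exact Real.smoothTransition.one_of_one_le hy.le
      rw [this.deriv_eq, deriv_const]
  obtain ⟨M, hM⟩ := hcs.exists_bound_of_continuous hcont
  refine ⟨M.toNNReal + 1, by positivity, lipschitzWith_of_nnnorm_deriv_le
    (hd.differentiable one_ne_zero) fun x => ?_⟩
  rw [← NNReal.coe_le_coe, coe_nnnorm]
  have := (hM x).trans (Real.le_coe_toNNReal M)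
  push_cast
  linarith

/-- Radial cutoffs between `B_s` and `B_{s+t}` with gradient at most `C / t`, where `C` depends on
neither `s` nor `t`, and whose nontrivial superlevel sets are balls centred at `p`. -/
theorem exists_radial_cutoff (n : ℕ) : ∃ C > 0, ∀ (p : EuclideanSpace ℝ (Fin n)) (s t : ℝ),
    0 < s → 0 < t → ∃ φ : EuclideanSpace ℝ (Fin n) → ℝ, ContDiff ℝ 1 φ ∧
      (∀ x, 0 ≤ φ x) ∧ (∀ x, φ x ≤ 1) ∧ (∀ x ∈ Metric.ball p s, φ x = 1) ∧
      Function.support φ ⊆ Metric.ball p (s + t) ∧ (∀ x, ‖fderiv ℝ φ x‖ ≤ C / t) ∧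
      ∀ c, 0 ≤ c → c < 1 → ∃ R, 0 < R ∧ R ≤ s + t ∧ {x | c < φ x} = Metric.ball p R := by
  obtain ⟨C, hC, hlip⟩ := exists_lipschitz_smoothTransition
  refine ⟨C, hC, fun p s t hs ht => ?_⟩
  set φ : EuclideanSpace ℝ (Fin n) → ℝ := fun x => Real.smoothTransition ((s + t - ‖x - p‖) / t)
  have hone : ∀ x ∈ Metric.ball p s, φ x = 1 := by
    intro x hx
    rw [mem_ball_iff_norm] at hx
    refine Real.smoothTransition.one_of_one_le ?_
    rw [le_div_iff₀ ht]; linarith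
  refine ⟨φ, ?_, fun x => Real.smoothTransition.nonneg _, fun x => Real.smoothTransition.le_one _,
    hone, ?_, ?_, ?_⟩
  · rw [contDiff_iff_contDiffAt]
    intro x
    by_cases hx : x = p
    · have : φ =ᶠ[𝓝 x] fun _ => 1 := by
        filter_upwards [Metric.ball_mem_nhds x hs] with y hy
        exact hone y (hx ▸ hy)
      exact contDiffAt_const.congr_of_eventuallyEq this
    · have h1 : ContDiffAt ℝ 1 (fun x : EuclideanSpace ℝ (Fin n) => ‖x - p‖) x :=
        (contDiffAt_id.sub contDiffAt_const).norm ℝ (sub_ne_zero.2 hx)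
      exact Real.smoothTransition.contDiff.contDiffAt.comp x
        ((contDiffAt_const.sub h1).div_const t)
  · intro x hx
    rw [mem_ball_iff_norm]
    by_contra hne
    exact hx (Real.smoothTransition.zero_of_nonpos
      (div_nonpos_of_nonpos_of_nonneg (by linarith) ht.le))
  · intro x
    have hL : LipschitzWith (C / t.toNNReal) φ := by
      refine LipschitzWith.of_dist_le_mul fun x y => ?_
      refine (hlip.dist_le_mul _ _).trans ?_
      rw [Real.dist_eq, ← sub_div, abs_div, abs_of_pos ht, NNReal.coe_div,
        Real.coe_toNNReal _ ht.le, mul_div_assoc', div_mul_eq_mul_div]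
      gcongr
      have : s + t - ‖x - p‖ - (s + t - ‖y - p‖) = ‖y - p‖ - ‖x - p‖ := by ring
      rw [this, dist_comm, dist_eq_norm]
      refine (abs_norm_sub_norm_le _ _).trans (le_of_eq ?_)
      congr 1; abel
    have := norm_fderiv_le_of_lipschitz ℝ hL (x₀ := x)
    rwa [NNReal.coe_div, Real.coe_toNNReal _ ht.le] at this
  · intro c hc0 hc1
    set S : Set ℝ := {v | Real.smoothTransition v ≤ c}
    have hcl : IsClosed S := isClosed_le Real.smoothTransition.continuous continuous_const
    have h0S : (0 : ℝ) ∈ S := by simpa [S, Real.smoothTransition.zero] using hc0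
    have hbd : ∀ v ∈ S, v ≤ 1 := by
      intro v hv
      by_contra hlt
      have hv' : Real.smoothTransition v ≤ c := hv
      rw [Real.smoothTransition.one_of_one_le (not_le.1 hlt).le] at hv'
      linarith
    have hbdd : BddAbove S := ⟨1, hbd⟩
    have hmem : sSup S ∈ S := hcl.csSup_mem ⟨0, h0S⟩ hbdd
    have hv0 : 0 ≤ sSup S := le_csSup hbdd h0S
    have hv1 : sSup S ≤ 1 := hbd _ hmem
    refine ⟨s + t - t * sSup S, by nlinarith, by nlinarith, ?_⟩
    ext x
    have hiff : c < φ x ↔ sSup S < (s + t - ‖x - p‖) / t := by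
      constructor
      · intro hx
        by_contra hle
        exact absurd ((Real.smoothTransition.monotone (not_lt.1 hle)).trans hmem) (not_le.2 hx)
      · intro hx
        by_contra hle
        exact absurd (le_csSup hbdd (show _ ∈ S from not_lt.1 hle)) (not_le.2 hx)
    rw [mem_ofPred_eq, hiff, mem_ball_iff_norm, lt_div_iff₀ ht]
    constructor <;> intro <;> linarith

/-- By the layer cake formula, a comparison of two measures on the superlevel sets of `φ` gives a
comparison of the integrals of `φ`. -/
theorem lintegral_le_of_superlevel_le {α : Type*} [MeasurableSpace α] {μ ν : Measure α} {k : ℝ≥0∞}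
    {φ : α → ℝ} (hφ : Measurable φ) (h0 : ∀ x, 0 ≤ φ x) (h1 : ∀ x, φ x ≤ 1)
    (h : ∀ c, 0 ≤ c → c < 1 → μ {x | c < φ x} ≤ k * ν {x | c < φ x}) :
    ∫⁻ x, ENNReal.ofReal (φ x) ∂μ ≤ k * ∫⁻ x, ENNReal.ofReal (φ x) ∂ν := by
  have hk : Antitone fun c : ℝ => ν {x | c < φ x} := fun c d hcd =>
    measure_mono fun x hx => lt_of_le_of_lt hcd hx
  rw [lintegral_eq_lintegral_meas_lt μ (Eventually.of_forall h0) hφ.aemeasurable,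
    lintegral_eq_lintegral_meas_lt ν (Eventually.of_forall h0) hφ.aemeasurable,
    ← lintegral_const_mul _ hk.measurable]
  refine setLIntegral_mono' measurableSet_Ioi fun c hc => ?_
  by_cases hc1 : c < 1
  · exact h c (le_of_lt hc) hc1
  · have : {x | c < φ x} = ∅ := by
      ext x
      simpa using (h1 x).trans (not_lt.1 hc1)
    simp [this]

/-- A Caccioppoli-type estimate: the perimeter in `B_s` is bounded by the volume of `E` in
`B_{s+t}`. The constant depends only on the dimension. -/
theorem exists_measureReal_ball_le (n : ℕ) : ∃ C > 0,
    ∀ (E : Set (EuclideanSpace ℝ (Fin n))) (τ : Measure (EuclideanSpace ℝ (Fin n)))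
      (σ : EuclideanSpace ℝ (Fin n) → EuclideanSpace ℝ (Fin n)) (b p : EuclideanSpace ℝ (Fin n))
      (ρ₀ : ℝ), IsPolarDecomposition E τ σ → MeasurableSet E → ‖b‖ = 1 →
      (∀ ρ, 0 < ρ → ρ ≤ ρ₀ →
        ∫ q in Metric.ball p ρ, ‖σ q - b‖ ∂τ ≤ 1 / 2 * τ.real (Metric.ball p ρ)) →
      ∀ s t, 0 < s → 0 < t → s + t ≤ ρ₀ →
        τ.real (Metric.ball p s) ≤ C / t * volume.real (E ∩ Metric.ball p (s + t)) := by
  obtain ⟨C, hC, hcut⟩ := exists_radial_cutoff n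
  refine ⟨2 * C, by positivity, ?_⟩
  intro E τ σ b p ρ₀ h hE hb hhalf s t hs ht hst
  have := h.isLocallyFinite
  obtain ⟨φ, hφ, hφ0, hφ1, hφs, hsupp, hgrad, hlev⟩ := hcut p s t hs ht
  have hc : HasCompactSupport φ := HasCompactSupport.of_support_subset_isCompact
    (isCompact_closedBall p (s + t)) (hsupp.trans Metric.ball_subset_closedBall)
  have hmeas : Measurable fun q => ‖σ q - b‖ := (h.measurable.sub_const b).norm
  have hφi : Integrable φ τ := hφ.continuous.integrable_of_hasCompactSupport hc
  have hbd : ∀ᵐ q ∂τ, ‖‖σ q - b‖‖ ≤ 2 := by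
    filter_upwards [h.norm_eq_one] with q hq
    rw [norm_norm]
    refine (norm_sub_le _ _).trans ?_
    rw [hq, hb]; norm_num
  have hi2 : Integrable (fun q => φ q * ‖σ q - b‖) τ :=
    hφi.mul_bdd hmeas.aestronglyMeasurable hbd
  -- The deviation of the normal from `b`, weighted by `φ`, is controlled through the superlevel
  -- sets of `φ`, which are balls centred at `p`.
  have hlayer : ∫ q, φ q * ‖σ q - b‖ ∂τ ≤ 1 / 2 * ∫ q, φ q ∂τ := by
    have h1 := lintegral_le_of_superlevel_le
      (μ := τ.withDensity fun q => ENNReal.ofReal ‖σ q - b‖) (ν := τ)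
      (k := ENNReal.ofReal (1 / 2)) hφ.continuous.measurable hφ0 hφ1 (by
        intro c hc0 hc1
        obtain ⟨R, hR0, hR, hset⟩ := hlev c hc0 hc1
        rw [hset, withDensity_apply _ Metric.isOpen_ball.measurableSet,
          ← ofReal_integral_eq_lintegral_ofReal (h.integrableOn_norm_sub b Metric.isBounded_ball)
            (Eventually.of_forall fun _ => norm_nonneg _),
          ← ofReal_measureReal (measure_ball_lt_top (μ := τ)).ne,
          ← ENNReal.ofReal_mul (by norm_num)]
        exact ENNReal.ofReal_le_ofReal (hhalf R hR0 (hR.trans hst)))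
    rw [lintegral_withDensity_eq_lintegral_mul _ hmeas.ennreal_ofReal
      hφ.continuous.measurable.ennreal_ofReal] at h1
    have e : ∀ q, ((fun q => ENNReal.ofReal ‖σ q - b‖) * fun q => ENNReal.ofReal (φ q)) q =
        ENNReal.ofReal (φ q * ‖σ q - b‖) := fun q => by
      rw [Pi.mul_apply, ENNReal.ofReal_mul (hφ0 q), mul_comm]
    simp only [e] at h1
    rw [← ofReal_integral_eq_lintegral_ofReal hi2
        (Eventually.of_forall fun q => mul_nonneg (hφ0 q) (norm_nonneg _)),
      ← ofReal_integral_eq_lintegral_ofReal hφi (Eventually.of_forall hφ0),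
      ← ENNReal.ofReal_mul (by norm_num)] at h1
    exact (ENNReal.ofReal_le_ofReal_iff
      (mul_nonneg (by norm_num) (integral_nonneg hφ0))).1 h1
  have hinner : ∫ q, φ q ∂τ - ∫ q, φ q * ‖σ q - b‖ ∂τ ≤ ∫ q, φ q * inner ℝ b (σ q) ∂τ := by
    rw [← integral_sub hφi hi2]
    refine integral_mono (hφi.sub hi2) ?_ fun q => ?_
    · refine hφi.mul_bdd (c := 1) (measurable_const.inner h.measurable).aestronglyMeasurable ?_
      filter_upwards [h.norm_eq_one] with q hq
      simpa [hq, hb] using norm_inner_le_norm (𝕜 := ℝ) b (σ q)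
    · have e : inner ℝ b (σ q) = 1 + inner ℝ b (σ q - b) := by
        rw [inner_sub_right, real_inner_self_eq_norm_sq, hb]; ring
      have h2 := neg_le_of_abs_le (abs_real_inner_le_norm b (σ q - b))
      rw [hb, one_mul] at h2
      have := mul_le_mul_of_nonneg_left h2 (hφ0 q)
      simp only
      rw [e]
      linarith
  have hgg := h.setIntegral_fderiv hφ hc b
  have hbound : ‖∫ q in E, fderiv ℝ φ q b‖ ≤
      C / t * volume.real (E ∩ Metric.ball p (s + t)) := by
    rw [setIntegral_eq_of_subset_of_forall_sdiff_eq_zero hE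
      (inter_subset_left (s := E) (t := Metric.ball p (s + t))) (fun q hq => ?_)]
    · refine norm_setIntegral_le_of_norm_le_const ?_ fun q _ => ?_
      · exact (measure_mono inter_subset_right).trans_lt (measure_ball_lt_top (μ := volume))
      · refine (ContinuousLinearMap.le_opNorm _ _).trans ?_
        rw [hb, mul_one]; exact hgrad q
    -- Outside the ball `φ` attains its minimum, so its gradient vanishes.
    · have h0 : φ q = 0 := by
        by_contra hne
        exact hq.2 ⟨hq.1, hsupp hne⟩
      have hmin : IsLocalMin φ q := Eventually.of_forall fun x => h0 ▸ hφ0 x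
      simp [hmin.fderiv_eq_zero]
  have hτs : τ.real (Metric.ball p s) ≤ ∫ q, φ q ∂τ := by
    have h1 : ∫ q in Metric.ball p s, φ q ∂τ = τ.real (Metric.ball p s) := by
      rw [setIntegral_congr_fun Metric.isOpen_ball.measurableSet (fun q hq => hφs q hq)]
      simp
    rw [← h1]
    exact setIntegral_le_integral hφi (Eventually.of_forall hφ0)
  rw [hgg, norm_neg] at hbound
  have h5 := (le_abs_self _).trans hbound
  have h6 : 2 * C / t * volume.real (E ∩ Metric.ball p (s + t)) =
    2 * (C / t * volume.real (E ∩ Metric.ball p (s + t))) := by ring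
  rw [h6]
  linarith

/-! ### Density estimates and blow-up -/

/-- The open half ball of radius `t` centred at the origin, on the side to which `b` points. -/
def halfBall (b : EuclideanSpace ℝ (Fin n)) (t : ℝ) : Set (EuclideanSpace ℝ (Fin n)) :=
  {w | ‖w‖ < t ∧ 0 < inner ℝ w b}

theorem isOpen_halfBall (b : EuclideanSpace ℝ (Fin n)) (t : ℝ) : IsOpen (halfBall b t) :=
  (isOpen_lt continuous_norm continuous_const).inter
    (isOpen_lt continuous_const (by fun_prop : Continuous fun w => inner ℝ w b))

theorem halfBall_subset_ball (b : EuclideanSpace ℝ (Fin n)) (t : ℝ) :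
    halfBall b t ⊆ Metric.ball 0 t := fun _ hw => mem_ball_zero_iff.2 hw.1

theorem volume_halfBall_lt_top (b : EuclideanSpace ℝ (Fin n)) (t : ℝ) :
    volume (halfBall b t) < ∞ :=
  (measure_mono (halfBall_subset_ball b t)).trans_lt measure_ball_lt_top

theorem measureReal_halfBall_one_pos {b : EuclideanSpace ℝ (Fin n)} (hb : ‖b‖ = 1) :
    0 < volume.real (halfBall b 1) := by
  refine ENNReal.toReal_pos ((isOpen_halfBall b 1).measure_pos volume ⟨(1 / 2 : ℝ) • b, ?_, ?_⟩).ne'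
    (volume_halfBall_lt_top b 1).ne
  · rw [norm_smul, hb]; norm_num
  · rw [real_inner_smul_left, real_inner_self_eq_norm_sq, hb]; norm_num

open scoped Pointwise in
theorem measureReal_halfBall (b : EuclideanSpace ℝ (Fin n)) {t : ℝ} (ht : 0 < t) :
    volume.real (halfBall b t) = t ^ n * volume.real (halfBall b 1) := by
  have : halfBall b t = t • halfBall b 1 := by
    ext w
    rw [mem_smul_set_iff_inv_smul_mem₀ ht.ne']
    simp only [halfBall, mem_ofPred_eq, norm_smul, real_inner_smul_left, norm_inv, Real.norm_eq_abs,
      abs_of_pos ht]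
    rw [inv_mul_lt_iff₀ ht, mul_one, mul_pos_iff_of_pos_left (inv_pos.2 ht)]
  rw [this, Measure.real, Measure.addHaar_smul, ENNReal.toReal_mul, finrank_euclideanSpace_fin,
    ENNReal.toReal_ofReal (abs_nonneg _), abs_of_pos (by positivity), Measure.real]

/-- Fubini's theorem and the averaging principle: if every translation by `w ∈ W` moves at most
measure `e` of `A` out of `E`, then for some `x ∈ A` the set `x + W` lies in `E` up to measure
`e |W| / |A|`. -/
theorem exists_translate_measure_le {A W : Set (EuclideanSpace ℝ (Fin n))} (hE : MeasurableSet E)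
    (hA0 : 0 < volume.real A) (hW : MeasurableSet W)
    (hWf : volume W ≠ ∞) {e : ℝ} (he : 0 ≤ e)
    (h : ∀ w ∈ W, volume.real {x | x ∈ A ∧ x + w ∉ E} ≤ e) :
    ∃ x ∈ A, volume.real {w | w ∈ W ∧ x + w ∉ E} * volume.real A ≤ e * volume.real W := by
  obtain ⟨hA1, hA2⟩ := ENNReal.toReal_pos_iff.1 hA0
  set g : EuclideanSpace ℝ (Fin n) → EuclideanSpace ℝ (Fin n) → ℝ≥0∞ :=
    fun x w => Eᶜ.indicator (fun _ => 1) (x + w)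
  have hg : Measurable (Function.uncurry g) :=
    (measurable_const.indicator hE.compl).comp (measurable_fst.add measurable_snd)
  have hg1 : ∀ x, ∫⁻ w in W, g x w = volume {w | w ∈ W ∧ x + w ∉ E} := by
    intro x
    have hm : MeasurableSet ((fun w => x + w) ⁻¹' Eᶜ) := (measurable_const_add x) hE.compl
    have : ∀ w, g x w = ((fun w => x + w) ⁻¹' Eᶜ).indicator (fun _ => 1) w := fun w => rfl
    simp only [this]
    rw [lintegral_indicator hm, setLIntegral_one, Measure.restrict_apply hm, inter_comm]
    rfl
  have hg2 : ∀ w, ∫⁻ x in A, g x w = volume {x | x ∈ A ∧ x + w ∉ E} := by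
    intro w
    have hm : MeasurableSet ((fun x => x + w) ⁻¹' Eᶜ) := (measurable_add_const w) hE.compl
    have : ∀ x, g x w = ((fun x => x + w) ⁻¹' Eᶜ).indicator (fun _ => 1) x := fun x => rfl
    simp only [this]
    rw [lintegral_indicator hm, setLIntegral_one, Measure.restrict_apply hm, inter_comm]
    rfl
  have hfin : ∀ w, volume {x | x ∈ A ∧ x + w ∉ E} ≠ ∞ := fun w =>
    ((measure_mono fun x hx => hx.1).trans_lt hA2).ne
  have htot : ∫⁻ x in A, ∫⁻ w in W, g x w ≤ ENNReal.ofReal e * volume W := by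
    rw [lintegral_lintegral_swap hg.aemeasurable, ← setLIntegral_const]
    refine setLIntegral_mono' hW fun w hw => ?_
    rw [hg2, ← ofReal_measureReal (hfin w)]
    exact ENNReal.ofReal_le_ofReal (h w hw)
  obtain ⟨x, hx, hxle⟩ := exists_le_setLAverage (μ := volume) (s := A)
    (f := fun x => ∫⁻ w in W, g x w) hA1.ne' hA2.ne
    hg.lintegral_prod_right'.aemeasurable
  refine ⟨x, hx, ?_⟩
  rw [hg1, setLAverage_eq] at hxle
  have h3 : volume {w | w ∈ W ∧ x + w ∉ E} * volume A ≤ ENNReal.ofReal e * volume W :=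
    ((ENNReal.le_div_iff_mul_le (Or.inl hA1.ne') (Or.inl hA2.ne)).1 hxle).trans htot
  have h4 := ENNReal.toReal_mono (by finiteness) h3
  rwa [ENNReal.toReal_mul, ENNReal.toReal_mul, ENNReal.toReal_ofReal he] at h4

theorem volume_inter_ball_lt_top (E : Set (EuclideanSpace ℝ (Fin n)))
    (p : EuclideanSpace ℝ (Fin n)) (s : ℝ) : volume (E ∩ Metric.ball p s) < ∞ :=
  (measure_mono inter_subset_right).trans_lt measure_ball_lt_top

theorem measureReal_inter_ball_mono (E : Set (EuclideanSpace ℝ (Fin n)))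
    (p : EuclideanSpace ℝ (Fin n)) {s t : ℝ} (h : s ≤ t) :
    volume.real (E ∩ Metric.ball p s) ≤ volume.real (E ∩ Metric.ball p t) :=
  measureReal_mono (inter_subset_inter_right _ (Metric.ball_subset_ball h))
    (volume_inter_ball_lt_top E p t).ne

/-- On balls around `p` of radius at most `ρ₀`, the set `E` has positive volume, and it is almost
monotone in every direction `w` with `⟨w, b⟩ ≥ 0`: translation by `w` moves at most the fraction `ε`
of the volume of `E` out of `E`. The volume is measured in a larger ball, of radius `s + 2 t` for
vectors with `|w| ≤ t`. -/
structure NearlyConstantNormal (E : Set (EuclideanSpace ℝ (Fin n)))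
    (p b : EuclideanSpace ℝ (Fin n)) (ε ρ₀ : ℝ) : Prop where
  pos : ∀ s, 0 < s → s ≤ ρ₀ → 0 < volume.real (E ∩ Metric.ball p s)
  translate : ∀ s t (w : EuclideanSpace ℝ (Fin n)), 0 < s → 0 < t → s + 2 * t ≤ ρ₀ → ‖w‖ ≤ t →
    0 ≤ inner ℝ w b → volume.real {x | x ∈ E ∩ Metric.ball p s ∧ x + w ∉ E} ≤
      ε * volume.real (E ∩ Metric.ball p (s + 2 * t))

/-- The factor `|w| ≤ t` in the translation estimate cancels the factor `1 / t` in the perimeter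
estimate, so the constant `ε` does not depend on `t`. -/
theorem IsInnerNormalAt.exists_nearlyConstantNormal (hE : MeasurableSet E)
    {p b : EuclideanSpace ℝ (Fin n)} (h : IsInnerNormalAt E p b) {ε : ℝ} (hε : 0 < ε) :
    ∃ ρ₀ > 0, NearlyConstantNormal E p b ε ρ₀ := by
  obtain ⟨hb, τ, σ, hp, hpos, hlim⟩ := h
  obtain ⟨C, hC, hper⟩ := exists_measureReal_ball_le n
  obtain ⟨ρ₁, hρ₁, h1⟩ := hp.exists_integral_norm_sub_le hb hpos hlim (η := 1 / 2) (by norm_num)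
  obtain ⟨ρ₂, hρ₂, h2⟩ := hp.exists_integral_norm_sub_le hb hpos hlim (η := ε / C) (by positivity)
  have := hp.isLocallyFinite
  have hper' := hper E τ σ b p ρ₁ hp hE hb h1
  refine ⟨min ρ₁ ρ₂, lt_min hρ₁ hρ₂, ?_, ?_⟩
  · intro s hs hsρ
    have h3 := hper' (s / 2) (s / 2) (by positivity) (by positivity)
      (by rw [add_halves]; exact hsρ.trans (min_le_left _ _))
    rw [add_halves] at h3
    have h4 : 0 < τ.real (Metric.ball p (s / 2)) :=
      ENNReal.toReal_pos (hpos _ (by positivity)).ne' (measure_ball_lt_top (μ := τ)).ne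
    exact pos_of_mul_pos_right (h4.trans_le h3) (by positivity)
  · intro s t w hs ht hst hwt hwb
    have hs2 : s + t ≤ ρ₂ := by have := hst.trans (min_le_right _ _); linarith
    have h3 := hper' (s + t) t (by positivity) ht
      (by have := hst.trans (min_le_left _ _); linarith)
    have h4 := h2 (s + t) (by positivity) hs2
    rw [show s + t + t = s + 2 * t by ring] at h3
    calc volume.real {x | x ∈ E ∩ Metric.ball p s ∧ x + w ∉ E}
        ≤ ‖w‖ * ∫ q in Metric.ball p (s + ‖w‖), ‖σ q - b‖ ∂τ :=
          hp.measure_translate_diff_le hE hwb s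
      _ ≤ t * ∫ q in Metric.ball p (s + t), ‖σ q - b‖ ∂τ := by
          have hmono : ∫ q in Metric.ball p (s + ‖w‖), ‖σ q - b‖ ∂τ ≤
              ∫ q in Metric.ball p (s + t), ‖σ q - b‖ ∂τ :=
            setIntegral_mono_set (hp.integrableOn_norm_sub b Metric.isBounded_ball)
              (Eventually.of_forall fun _ => norm_nonneg _)
              (Metric.ball_subset_ball (by linarith)).eventuallyLE
          have h0 : 0 ≤ ∫ q in Metric.ball p (s + ‖w‖), ‖σ q - b‖ ∂τ :=
            integral_nonneg fun _ => norm_nonneg _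
          exact mul_le_mul hwt hmono h0 ht.le
      _ ≤ t * (ε / C * (C / t * volume.real (E ∩ Metric.ball p (s + 2 * t)))) := by
          exact mul_le_mul_of_nonneg_left
            (h4.trans (mul_le_mul_of_nonneg_left h3 (by positivity))) ht.le
      _ = _ := by field_simp

/-- Either the volume of `E` grows by the factor `2ⁿ` from `B_s` to `B_{s+2t}`, or `E` fills half
of some half ball of radius `t` with vertex in `B_s`. -/
theorem NearlyConstantNormal.growth_or_full (hE : MeasurableSet E)
    {p b : EuclideanSpace ℝ (Fin n)} {ε ρ₀ : ℝ} (h : NearlyConstantNormal E p b ε ρ₀)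
    (hε : 0 ≤ ε) (hε2 : ε * (2 * 2 ^ n) ≤ 1) {s t : ℝ} (hs : 0 < s) (ht : 0 < t)
    (hst : s + 2 * t ≤ ρ₀) :
    2 ^ n * volume.real (E ∩ Metric.ball p s) ≤ volume.real (E ∩ Metric.ball p (s + 2 * t)) ∨
      t ^ n * (volume.real (halfBall b 1) / 2) ≤ volume.real (E ∩ Metric.ball p (s + t)) := by
  refine or_iff_not_imp_left.2 fun hlt => ?_
  rw [not_le] at hlt
  have hms := h.pos s hs (by linarith)
  set m := volume.real (E ∩ Metric.ball p s)
  have hWm := (isOpen_halfBall b t).measurableSet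
  have hWf := (volume_halfBall_lt_top b t).ne
  obtain ⟨x, hx, hxle⟩ := exists_translate_measure_le (A := E ∩ Metric.ball p s) (W := halfBall b t)
    hE hms hWm hWf (e := m / 2) (by positivity) (by
      intro w hw
      refine (h.translate s t w hs ht hst hw.1.le hw.2.le).trans ?_
      calc _ ≤ ε * (2 ^ n * m) := by gcongr
        _ = ε * (2 * 2 ^ n) * (m / 2) := by ring
        _ ≤ 1 * (m / 2) := by gcongr
        _ = m / 2 := one_mul _)
  have h1 : volume.real {w | w ∈ halfBall b t ∧ x + w ∉ E} ≤ volume.real (halfBall b t) / 2 := by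
    refine le_of_mul_le_mul_right ?_ hms
    calc _ ≤ _ := hxle
      _ = _ := by ring
  have h2 : volume.real {w | w ∈ halfBall b t ∧ x + w ∈ E} ≤
      volume.real (E ∩ Metric.ball p (s + t)) := by
    have e : volume ((fun w => x + w) ⁻¹' (E ∩ Metric.ball p (s + t))) =
        volume (E ∩ Metric.ball p (s + t)) := measure_preimage_add _ _ _
    rw [Measure.real, Measure.real, ← e]
    refine ENNReal.toReal_mono (e ▸ (volume_inter_ball_lt_top E p _).ne) (measure_mono ?_)
    rintro w ⟨hw, hwE⟩
    refine ⟨hwE, ?_⟩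
    have hxs := hx.2
    rw [mem_ball_iff_norm] at hxs ⊢
    calc ‖x + w - p‖ = ‖(x - p) + w‖ := by congr 1; abel
      _ ≤ ‖x - p‖ + ‖w‖ := norm_add_le _ _
      _ < s + t := add_lt_add hxs hw.1
  have h3 : volume.real (halfBall b t) ≤ volume.real {w | w ∈ halfBall b t ∧ x + w ∉ E} +
      volume.real {w | w ∈ halfBall b t ∧ x + w ∈ E} := by
    refine (measureReal_mono (fun w hw => ?_) ?_).trans (measureReal_union_le _ _)
    · by_cases hwE : x + w ∈ E
      · exact Or.inr ⟨hw, hwE⟩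
      · exact Or.inl ⟨hw, hwE⟩
    · refine ((measure_mono ?_).trans_lt (volume_halfBall_lt_top b t)).ne
      rintro w (hw | hw) <;> exact hw.1
  rw [measureReal_halfBall b ht] at h1 h3
  linarith

/-- The lower density estimate at `p`. Both alternatives in `growth_or_full` propagate the bound
`|E ∩ B_s| ≥ c tⁿ` to `|E ∩ B_{s+4t}| ≥ c (2t)ⁿ`. For `s = R / 2` and some `t = 2⁻ʲ R / 8` it holds
because `|E ∩ B_{R/2}|` is positive, and `j` steps lead to `|E ∩ B_R| ≥ c (R / 8)ⁿ`. -/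
theorem NearlyConstantNormal.density_lower_bound (hE : MeasurableSet E)
    {p b : EuclideanSpace ℝ (Fin n)} (hb : ‖b‖ = 1) {ε ρ₀ : ℝ}
    (h : NearlyConstantNormal E p b ε ρ₀)
    (hε : 0 ≤ ε) (hε2 : ε * (2 * 2 ^ n) ≤ 1) {R : ℝ} (hR : 0 < R) (hRρ : R ≤ ρ₀) :
    (R / 8) ^ n * (volume.real (halfBall b 1) / 2) ≤ volume.real (E ∩ Metric.ball p R) := by
  -- In dimension zero there are no unit vectors.
  have hn : n ≠ 0 := by
    rintro rfl
    rw [Subsingleton.elim b 0] at hb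
    simp at hb
  set c := volume.real (halfBall b 1) / 2 with hc
  have hc0 : 0 < c := by have := measureReal_halfBall_one_pos hb; positivity
  have hm := h.pos (R / 2) (by positivity) (by linarith)
  obtain ⟨j, hj⟩ : ∃ j : ℕ, (R / 8 / 2 ^ j) ^ n * c ≤ volume.real (E ∩ Metric.ball p (R / 2)) := by
    have h1 : Tendsto (fun j : ℕ => (R / 8 / 2 ^ j) ^ n * c) atTop (𝓝 ((R / 8 * 0) ^ n * c)) := by
      refine Tendsto.mul_const _ (Tendsto.pow (Tendsto.const_mul _ ?_) n)
      exact tendsto_inv_atTop_zero.comp (tendsto_pow_atTop_atTop_of_one_lt one_lt_two)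
    rw [mul_zero, zero_pow hn, zero_mul] at h1
    exact ((h1.eventually (gt_mem_nhds hm)).exists).imp fun j hj => hj.le
  set t := R / 8 / 2 ^ j with ht
  have ht0 : 0 < t := by positivity
  have htj : t * 2 ^ j = R / 8 := by rw [ht]; field_simp
  clear_value t
  have key : ∀ i ≤ j, (2 ^ i * t) ^ n * c ≤
      volume.real (E ∩ Metric.ball p (R / 2 + 4 * t * (2 ^ i - 1))) := by
    intro i
    induction i with
    | zero => intro _; simpa using hj
    | succ i ih =>
      intro hi
      have hpre := ih (by omega)
      have h2i : (1 : ℝ) ≤ 2 ^ i := one_le_pow₀ one_le_two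
      have h2j : (2 : ℝ) ^ (i + 1) ≤ 2 ^ j := pow_le_pow_right₀ one_le_two hi
      have hsum : R / 2 + 4 * t * (2 ^ i - 1) + 2 * (2 ^ (i + 1) * t) =
          R / 2 + 4 * t * (2 ^ (i + 1) - 1) := by ring
      have hle : R / 2 + 4 * t * (2 ^ (i + 1) - 1) ≤ R := by nlinarith
      have hs : 0 < R / 2 + 4 * t * (2 ^ i - 1) := by
        have := mul_nonneg ht0.le (sub_nonneg.2 h2i)
        linarith
      rcases h.growth_or_full hE hε hε2 hs (t := 2 ^ (i + 1) * t) (by positivity)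
        (by rw [hsum]; linarith) with hg | hg
      · rw [hsum] at hg
        refine le_trans ?_ hg
        calc (2 ^ (i + 1) * t) ^ n * c = 2 ^ n * ((2 ^ i * t) ^ n * c) := by
              rw [mul_pow, mul_pow, ← pow_mul, ← pow_mul, add_mul, pow_add]; ring
          _ ≤ _ := by gcongr
      · refine hg.trans (measureReal_inter_ball_mono E p ?_)
        rw [← hsum]
        have : 0 < 2 ^ (i + 1) * t := by positivity
        linarith
  have hfin := key j le_rfl
  rw [mul_comm, ← mul_comm t, htj, mul_comm] at hfin
  refine hfin.trans (measureReal_inter_ball_mono E p ?_)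
  nlinarith

theorem IsInnerNormalAt.eventually_measureReal_diff_le_of_measurableSet (hE : MeasurableSet E)
    {p b : EuclideanSpace ℝ (Fin n)} (h : IsInnerNormalAt E p b) {δ κ : ℝ} (hδ : 0 < δ)
    (hδ1 : δ ≤ 1) (hκ : 0 < κ) :
    ∀ᶠ ρ in 𝓝[>] (0 : ℝ), volume.real
      ({y | y ∈ Metric.ball p ρ ∧ δ * ρ < inner ℝ (y - p) b} \ E) ≤ κ * ρ ^ n := by
  have hV := measureReal_halfBall_one_pos h.1
  set V := volume.real (halfBall b 1) with hVdef
  have hN : 0 < volume.real (Metric.ball (0 : EuclideanSpace ℝ (Fin n)) 1) :=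
    ENNReal.toReal_pos (Metric.measure_ball_pos volume _ one_pos).ne' measure_ball_lt_top.ne
  set N := volume.real (Metric.ball (0 : EuclideanSpace ℝ (Fin n)) 1) with hNdef
  -- The first bound is the one that the density estimate needs. The second makes
  -- `ε |E ∩ B_{5ρ}| |W| / |E ∩ B_{δρ}|`, with `W` the half ball of radius `2 ρ`, at most `κ ρⁿ`.
  set ε := min (1 / (2 * 2 ^ n)) (κ * (δ / 8) ^ n / (2 * N * 5 ^ n * 2 ^ n)) with hεdef
  have hε : 0 < ε := lt_min (by positivity) (by positivity)
  have hε2 : ε * (2 * 2 ^ n) ≤ 1 := by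
    rw [← le_div_iff₀ (by positivity)]; exact min_le_left _ _
  have hε3 : ε * (2 * N * 5 ^ n * 2 ^ n) ≤ κ * (δ / 8) ^ n := by
    rw [← le_div_iff₀ (by positivity)]; exact min_le_right _ _
  obtain ⟨ρ₀, hρ₀, hnc⟩ := h.exists_nearlyConstantNormal hE hε
  have hsmall : ∀ᶠ ρ in 𝓝[>] (0 : ℝ), ρ < ρ₀ / 5 :=
    mem_nhdsWithin_of_mem_nhds (gt_mem_nhds (by positivity))
  filter_upwards [hsmall, self_mem_nhdsWithin] with ρ hρ hρ0
  have hρ0 : 0 < ρ := hρ0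
  have hδρ : δ * ρ ≤ ρ := by nlinarith
  have hδρ0 : 0 < δ * ρ := by positivity
  have hdens := hnc.density_lower_bound hE h.1 hε.le hε2 hδρ0 (by linarith)
  have hms := hnc.pos (δ * ρ) hδρ0 (by linarith)
  have hbig : volume.real (E ∩ Metric.ball p (δ * ρ + 2 * (2 * ρ))) ≤ (5 * ρ) ^ n * N := by
    calc _ ≤ volume.real (Metric.ball p (5 * ρ)) :=
          measureReal_mono (inter_subset_right.trans (Metric.ball_subset_ball (by linarith)))
            measure_ball_lt_top.ne
      _ = _ := by
        rw [Measure.real, Measure.addHaar_ball_of_pos _ _ (by positivity), ENNReal.toReal_mul,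
          ENNReal.toReal_ofReal (by positivity), finrank_euclideanSpace_fin, hNdef, Measure.real]
  obtain ⟨x, hx, hxle⟩ := exists_translate_measure_le (A := E ∩ Metric.ball p (δ * ρ))
    (W := halfBall b (2 * ρ)) hE hms
    (isOpen_halfBall b _).measurableSet (volume_halfBall_lt_top b _).ne
    (e := ε * ((5 * ρ) ^ n * N)) (by positivity) (by
      intro w hw
      refine (hnc.translate (δ * ρ) (2 * ρ) w hδρ0 (by positivity) (by linarith) hw.1.le
        hw.2.le).trans ?_
      gcongr)
  rw [measureReal_halfBall b (by positivity : 0 < 2 * ρ), ← hVdef] at hxle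
  -- A vector from `x ∈ B_{δρ}(p)` to a point of the cap lies in the half ball of radius `2 ρ`.
  have hsub : volume.real ({y | y ∈ Metric.ball p ρ ∧ δ * ρ < inner ℝ (y - p) b} \ E) ≤
      volume.real {w | w ∈ halfBall b (2 * ρ) ∧ x + w ∉ E} := by
    set D := {y | y ∈ Metric.ball p ρ ∧ δ * ρ < inner ℝ (y - p) b} \ E
    have e : volume ((fun w => x + w) ⁻¹' D) = volume D := measure_preimage_add _ _ _
    rw [Measure.real, Measure.real, ← e]
    refine ENNReal.toReal_mono ?_ (measure_mono ?_)
    · exact ((measure_mono fun w hw => hw.1).trans_lt (volume_halfBall_lt_top b (2 * ρ))).ne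
    · rintro w ⟨⟨hw1, hw2⟩, hwE⟩
      have hxs := hx.2
      rw [mem_ball_iff_norm] at hxs hw1
      refine ⟨⟨?_, ?_⟩, hwE⟩
      · calc ‖w‖ = ‖(x + w - p) - (x - p)‖ := by congr 1; abel
          _ ≤ ‖x + w - p‖ + ‖x - p‖ := norm_sub_le _ _
          _ < 2 * ρ := by linarith
      · have h5 := real_inner_le_norm (x - p) b
        rw [h.1, mul_one] at h5
        have h6 : inner ℝ (x + w - p) b = inner ℝ (x - p) b + inner ℝ w b := by
          rw [← inner_add_left]; congr 1; abel
        linarith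
  refine hsub.trans ?_
  have hA : 0 < (δ * ρ / 8) ^ n * (V / 2) := by positivity
  refine le_of_mul_le_mul_right ?_ hA
  calc _ ≤ volume.real {w | w ∈ halfBall b (2 * ρ) ∧ x + w ∉ E} *
        volume.real (E ∩ Metric.ball p (δ * ρ)) := by gcongr
    _ ≤ _ := hxle
    _ = (ε * (2 * N * 5 ^ n * 2 ^ n)) * (ρ ^ n * ρ ^ n * (V / 2)) := by
      rw [mul_pow, mul_pow]; ring
    _ ≤ (κ * (δ / 8) ^ n) * (ρ ^ n * ρ ^ n * (V / 2)) := by gcongr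
    _ = _ := by rw [div_pow, div_pow, mul_pow]; ring

/-- The blow-up of `E` at a point with inner normal `b` contains the half space `⟨·, b⟩ > 0`.
Applied to the complement of `E`, with `-b`, it shows that the blow-up is this half space. -/
theorem IsInnerNormalAt.eventually_measureReal_diff_le (hE : NullMeasurableSet E volume)
    {p b : EuclideanSpace ℝ (Fin n)} (h : IsInnerNormalAt E p b) {δ κ : ℝ} (hδ : 0 < δ)
    (hδ1 : δ ≤ 1) (hκ : 0 < κ) :
    ∀ᶠ ρ in 𝓝[>] (0 : ℝ), volume.real
      ({y | y ∈ Metric.ball p ρ ∧ δ * ρ < inner ℝ (y - p) b} \ E) ≤ κ * ρ ^ n := by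
  obtain ⟨E', -, hE', hae⟩ := hE.exists_measurable_superset_ae_eq
  filter_upwards [(h.congr hae.symm).eventually_measureReal_diff_le_of_measurableSet hE' hδ hδ1 hκ]
    with ρ hρ
  rwa [measureReal_congr ((ae_eq_refl _).diff hae.symm)]

/-! ### Comparison of inner normals -/

open scoped Pointwise in
theorem measureReal_preimage_rescale (V : Set (EuclideanSpace ℝ (Fin n)))
    (p : EuclideanSpace ℝ (Fin n)) {ρ : ℝ} (hρ : 0 < ρ) :
    volume.real {y | ρ⁻¹ • (y - p) ∈ V} = ρ ^ n * volume.real V := by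
  have : {y | ρ⁻¹ • (y - p) ∈ V} = (fun y => y + -p) ⁻¹' (ρ • V) := by
    ext y
    rw [mem_preimage, mem_smul_set_iff_inv_smul_mem₀ hρ.ne', ← sub_eq_add_neg]
    rfl
  rw [this, Measure.real, measure_preimage_add_right, Measure.addHaar_smul, ENNReal.toReal_mul,
    finrank_euclideanSpace_fin, ENNReal.toReal_ofReal (abs_nonneg _),
    abs_of_pos (by positivity), Measure.real]

/-- If a linear isometry `O` maps `q` to `p` and maps `E` into `E` near `q`, then it maps the inner
normal at `q` to the inner normal at `p`. Otherwise the blow-ups leave room for a nonempty open set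
that lies both in the image of `E` and outside `E`. -/
theorem IsInnerNormalAt.map_eq_of_eventually_mapsTo (hE : NullMeasurableSet E volume)
    {p q a b : EuclideanSpace ℝ (Fin n)}
    (O : EuclideanSpace ℝ (Fin n) ≃ₗᵢ[ℝ] EuclideanSpace ℝ (Fin n)) (hO : O q = p)
    (hmaps : ∀ᶠ y in 𝓝 q, y ∈ E → O y ∈ E)
    (hq : IsInnerNormalAt E q a) (hp : IsInnerNormalAt E p b) : O a = b := by
  by_contra hne
  have ha : ‖O a‖ = 1 := by rw [O.norm_map, hq.1]
  have hlt : inner ℝ (O a) b < 1 := (inner_lt_one_iff_real_of_norm_eq_one ha hp.1).2 hne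
  have hge : -1 ≤ inner ℝ (O a) b := by
    have := neg_le_of_abs_le (abs_real_inner_le_norm (O a) b)
    rwa [ha, hp.1, one_mul] at this
  set δ := (1 - inner ℝ (O a) b) / 8 with hδdef
  have hδ : 0 < δ := by rw [hδdef]; linarith
  have hδ1 : δ ≤ 1 := by rw [hδdef]; linarith
  set V : Set (EuclideanSpace ℝ (Fin n)) :=
    {v | ‖v‖ < 1 ∧ δ < inner ℝ v (O a) ∧ inner ℝ v b < -δ}
  have hVopen : IsOpen V :=
    (isOpen_lt continuous_norm continuous_const).inter
      ((isOpen_lt continuous_const (by fun_prop : Continuous fun v => inner ℝ v (O a))).inter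
        (isOpen_lt (by fun_prop : Continuous fun v => inner ℝ v b) continuous_const))
  -- `V` is nonempty because `⟨O a - b, O a⟩ = 1 - ⟨O a, b⟩ = -⟨O a - b, b⟩` is positive.
  have hVne : V.Nonempty := by
    refine ⟨(1 / 4 : ℝ) • (O a - b), ?_, ?_, ?_⟩
    · rw [norm_smul]
      have := norm_sub_le (O a) b
      rw [ha, hp.1] at this
      norm_num
      linarith
    · rw [real_inner_smul_left, inner_sub_left, real_inner_self_eq_norm_sq, ha,
        real_inner_comm]
      linarith
    · rw [real_inner_smul_left, inner_sub_left, real_inner_self_eq_norm_sq, hp.1]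
      linarith
  have hVpos : 0 < volume.real V := by
    refine ENNReal.toReal_pos (hVopen.measure_pos volume hVne).ne' ?_
    refine ((measure_mono (t := Metric.ball 0 1) fun v hv => ?_).trans_lt measure_ball_lt_top).ne
    exact mem_ball_zero_iff.2 hv.1
  have h1 := hq.eventually_measureReal_diff_le hE hδ hδ1 (κ := volume.real V / 4) (by positivity)
  have h2 := (hp.compl hE).eventually_measureReal_diff_le hE.compl hδ hδ1
    (κ := volume.real V / 4) (by positivity)
  obtain ⟨r, hr, hmaps⟩ := Metric.eventually_nhds_iff_ball.1 hmaps
  have h3 : ∀ᶠ ρ in 𝓝[>] (0 : ℝ), ρ < r := mem_nhdsWithin_of_mem_nhds (gt_mem_nhds hr)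
  obtain ⟨ρ, ⟨⟨h1, h2⟩, h3⟩, hρ⟩ := (((h1.and h2).and h3).and self_mem_nhdsWithin).exists
  have hρ : 0 < ρ := hρ
  set D₁ := {y | y ∈ Metric.ball q ρ ∧ δ * ρ < inner ℝ (y - q) a} \ E
  set D₂ := {y | y ∈ Metric.ball p ρ ∧ δ * ρ < inner ℝ (y - p) (-b)} \ Eᶜ
  -- If `O⁻¹ y ∈ E` then `y ∈ E`, so every point of `p + ρ V` lies in one of the exceptional sets.
  have hsub : {y | ρ⁻¹ • (y - p) ∈ V} ⊆ O.symm ⁻¹' D₁ ∪ D₂ := by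
    rintro y ⟨hy1, hy2, hy3⟩
    rw [norm_smul, norm_inv, Real.norm_eq_abs, abs_of_pos hρ, inv_mul_lt_iff₀ hρ, mul_one] at hy1
    rw [real_inner_smul_left, lt_inv_mul_iff₀ hρ, mul_comm] at hy2
    rw [real_inner_smul_left, inv_mul_lt_iff₀ hρ] at hy3
    have hsymm : O.symm y - q = O.symm (y - p) := by rw [← hO, map_sub, O.symm_apply_apply]
    have hball : O.symm y ∈ Metric.ball q ρ := by
      rw [mem_ball_iff_norm, hsymm, O.symm.norm_map]; exact hy1
    by_cases hyE : O.symm y ∈ E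
    · right
      have := hmaps _ (Metric.ball_subset_ball h3.le hball) hyE
      rw [O.apply_symm_apply] at this
      refine ⟨⟨mem_ball_iff_norm.2 hy1, ?_⟩, fun h => h this⟩
      rw [inner_neg_right]
      linarith
    · left
      refine ⟨⟨hball, ?_⟩, hyE⟩
      rw [hsymm, ← O.inner_map_map, O.apply_symm_apply]
      exact hy2
  have hD₁ : volume.real (O.symm ⁻¹' D₁) = volume.real D₁ := by
    rw [Measure.real, Measure.real, O.symm.measurePreserving.measure_preimage_emb
      O.symm.toHomeomorph.measurableEmbedding]
  have hf₁ : volume D₁ ≠ ∞ :=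
    ((measure_mono fun y hy => hy.1.1).trans_lt (measure_ball_lt_top (x := q) (r := ρ))).ne
  have hf₂ : volume D₂ ≠ ∞ :=
    ((measure_mono fun y hy => hy.1.1).trans_lt (measure_ball_lt_top (x := p) (r := ρ))).ne
  have hf₁' : volume (O.symm ⁻¹' D₁) ≠ ∞ := by
    rwa [O.symm.measurePreserving.measure_preimage_emb O.symm.toHomeomorph.measurableEmbedding]
  have htot := (measureReal_mono hsub (measure_union_ne_top hf₁' hf₂)).trans
    (measureReal_union_le _ _)
  rw [measureReal_preimage_rescale V p hρ, hD₁] at htot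
  have : 0 < ρ ^ n * volume.real V := by positivity
  linarith

end Perimeter

/-! ### Reflections of circularly symmetric sets -/

variable {m : ℕ}

theorem joinXZ_xPart_zPart (v : EuclideanSpace ℝ (Fin (2 + m))) :
    joinXZ (xPart v) (zPart v) = v := by
  ext i
  refine Fin.addCases (fun i => ?_) (fun i => ?_) i <;> simp [joinXZ, xPart, zPart]

theorem inner_eq_xPart_add_zPart (v w : EuclideanSpace ℝ (Fin (2 + m))) :
    inner ℝ v w = inner ℝ (xPart v) (xPart w) + inner ℝ (zPart v) (zPart w) := by
  simp only [PiLp.inner_apply, xPart, zPart, Fin.sum_univ_add]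

theorem norm_sq_eq_xPart_add_zPart (v : EuclideanSpace ℝ (Fin (2 + m))) :
    ‖v‖ ^ 2 = ‖xPart v‖ ^ 2 + ‖zPart v‖ ^ 2 := by
  simp only [← real_inner_self_eq_norm_sq, inner_eq_xPart_add_zPart]

theorem continuous_xPart : Continuous (xPart (m := m)) := by
  unfold xPart
  fun_prop

/-- For given `|x|` and `z`, membership in `symmSet μ` is monotone in `⟨x, e₁⟩`. -/
theorem symmSet_of_inner_le {μ : ℝ × EuclideanSpace ℝ (Fin m) → ℝ}
    {p q : EuclideanSpace ℝ (Fin (2 + m))} (hx : ‖xPart p‖ = ‖xPart q‖) (hz : zPart p = zPart q)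
    (h : inner ℝ (xPart q) (EuclideanSpace.single 0 1) ≤
      inner ℝ (xPart p) (EuclideanSpace.single 0 (1 : ℝ)))
    (hq : q ∈ symmSet μ) : p ∈ symmSet μ := by
  obtain ⟨h0, hlt⟩ := hq
  refine ⟨by rwa [← norm_ne_zero_iff, hx, norm_ne_zero_iff], ?_⟩
  rw [hx, hz]
  refine lt_of_le_of_lt ?_ hlt
  refine mul_le_mul_of_nonneg_left (Real.arccos_le_arccos ?_) (by positivity)
  rw [hat, hat, real_inner_smul_left, real_inner_smul_left, hx]
  exact mul_le_mul_of_nonneg_left h (by positivity)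

theorem norm_tangential_sq {x : EuclideanSpace ℝ (Fin 2)} (hx : x ≠ 0)
    (ν : EuclideanSpace ℝ (Fin (2 + m))) :
    ‖tangential x ν‖ ^ 2 = ‖xPart ν‖ ^ 2 - inner ℝ (hat x) (xPart ν) ^ 2 := by
  have h1 : ‖hat x‖ = 1 := by
    rw [hat, norm_smul, norm_inv, norm_norm, inv_mul_cancel₀ (norm_ne_zero_iff.2 hx)]
  rw [tangential, norm_sub_sq_real, norm_smul, h1, inner_smul_right, real_inner_comm,
    Real.norm_eq_abs, mul_one, sq_abs]
  ring

/-- The reflection of `ℝ² × ℝᵐ` that fixes `z` and reflects `x` across the line `dᗮ`. -/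
noncomputable def reflectX (m : ℕ) (d : EuclideanSpace ℝ (Fin 2)) :
    EuclideanSpace ℝ (Fin (2 + m)) ≃ₗᵢ[ℝ] EuclideanSpace ℝ (Fin (2 + m)) :=
  Submodule.reflection (Submodule.span ℝ {joinXZ d 0})ᗮ

theorem reflectX_apply (d : EuclideanSpace ℝ (Fin 2)) (v : EuclideanSpace ℝ (Fin (2 + m))) :
    reflectX m d v = v - (2 * (inner ℝ d (xPart v) / ‖d‖ ^ 2)) • joinXZ d 0 := by
  have h1 : inner ℝ (joinXZ d (0 : EuclideanSpace ℝ (Fin m))) v = inner ℝ d (xPart v) := by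
    rw [inner_eq_xPart_add_zPart, xPart_joinXZ, zPart_joinXZ, inner_zero_left, add_zero]
  have h2 : ‖joinXZ d (0 : EuclideanSpace ℝ (Fin m))‖ ^ 2 = ‖d‖ ^ 2 := by
    rw [norm_sq_eq_xPart_add_zPart, xPart_joinXZ, zPart_joinXZ]; simp
  rw [reflectX, Submodule.reflection_orthogonal_apply, Submodule.reflection_singleton_apply, h1]
  simp only [RCLike.ofReal_real_eq_id, id_eq, h2, neg_sub, mul_smul, two_smul]

theorem xPart_reflectX (d : EuclideanSpace ℝ (Fin 2)) (v : EuclideanSpace ℝ (Fin (2 + m))) :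
    xPart (reflectX m d v) = xPart v - (2 * (inner ℝ d (xPart v) / ‖d‖ ^ 2)) • d := by
  rw [reflectX_apply]
  ext i
  simp [xPart, joinXZ]

theorem zPart_reflectX (d : EuclideanSpace ℝ (Fin 2)) (v : EuclideanSpace ℝ (Fin (2 + m))) :
    zPart (reflectX m d v) = zPart v := by
  rw [reflectX_apply]
  ext i
  simp [zPart, joinXZ]

theorem norm_xPart_reflectX (d : EuclideanSpace ℝ (Fin 2)) (v : EuclideanSpace ℝ (Fin (2 + m))) :
    ‖xPart (reflectX m d v)‖ = ‖xPart v‖ := by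
  have h := norm_sq_eq_xPart_add_zPart (reflectX m d v)
  rw [(reflectX m d).norm_map, zPart_reflectX, norm_sq_eq_xPart_add_zPart v] at h
  exact (pow_left_inj₀ (norm_nonneg _) (norm_nonneg _) two_ne_zero).1 (by linarith)

theorem inner_sub_self_of_norm_eq {F : Type*} [NormedAddCommGroup F] [InnerProductSpace ℝ F]
    {x y : F} (h : ‖x‖ = ‖y‖) : inner ℝ (y - x) y = ‖y - x‖ ^ 2 / 2 := by
  rw [norm_sub_sq_real, h, inner_sub_left, real_inner_self_eq_norm_sq, real_inner_comm]
  ring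

theorem reflectX_sub_joinXZ {x y : EuclideanSpace ℝ (Fin 2)} (h : ‖x‖ = ‖y‖) (hne : x ≠ y)
    (z : EuclideanSpace ℝ (Fin m)) : reflectX m (y - x) (joinXZ y z) = joinXZ x z := by
  have hd : ‖y - x‖ ≠ 0 := norm_ne_zero_iff.2 (sub_ne_zero.2 hne.symm)
  rw [← joinXZ_xPart_zPart (reflectX m (y - x) (joinXZ y z)), xPart_reflectX, zPart_reflectX,
    xPart_joinXZ, zPart_joinXZ, inner_sub_self_of_norm_eq h]
  congr 1
  have : 2 * (‖y - x‖ ^ 2 / 2 / ‖y - x‖ ^ 2) = 1 := by field_simp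
  rw [this, one_smul, sub_sub_cancel]

theorem eventually_reflectX_mem_symmSet (μ : ℝ × EuclideanSpace ℝ (Fin m) → ℝ)
    {x y : EuclideanSpace ℝ (Fin 2)} (h : ‖x‖ = ‖y‖) (hne : x ≠ y)
    (hle : inner ℝ y (EuclideanSpace.single 0 1) ≤ inner ℝ x (EuclideanSpace.single 0 (1 : ℝ)))
    (z : EuclideanSpace ℝ (Fin m)) :
    ∀ᶠ v in 𝓝 (joinXZ y z), v ∈ symmSet μ → reflectX m (y - x) v ∈ symmSet μ := by
  have hd : 0 < ‖y - x‖ := norm_pos_iff.2 (sub_ne_zero.2 hne.symm)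
  have hcont : Continuous fun v : EuclideanSpace ℝ (Fin (2 + m)) => inner ℝ (y - x) (xPart v) :=
    continuous_const.inner continuous_xPart
  have hpos : 0 < inner ℝ (y - x) (xPart (joinXZ y z)) := by
    rw [xPart_joinXZ, inner_sub_self_of_norm_eq h]; positivity
  filter_upwards [hcont.continuousAt.eventually (lt_mem_nhds hpos)] with v hv
  refine symmSet_of_inner_le (norm_xPart_reflectX _ v) (zPart_reflectX _ v) ?_
  have hd1 : inner ℝ (y - x) (EuclideanSpace.single 0 (1 : ℝ)) ≤ 0 := by
    rw [inner_sub_left]; linarith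
  rw [xPart_reflectX, inner_sub_left _ _ (EuclideanSpace.single 0 (1 : ℝ)), real_inner_smul_left]
  have : 0 ≤ 2 * (inner ℝ (y - x) (xPart v) / ‖y - x‖ ^ 2) := by positivity
  nlinarith

theorem circular_components_eq_of_inner_le {μ : ℝ × EuclideanSpace ℝ (Fin m) → ℝ}
    (hF : NullMeasurableSet (symmSet μ) volume) {x y : EuclideanSpace ℝ (Fin 2)}
    {z : EuclideanSpace ℝ (Fin m)} (hx0 : x ≠ 0) (hy0 : y ≠ 0) (h : ‖x‖ = ‖y‖)
    (hle : inner ℝ y (EuclideanSpace.single 0 1) ≤ inner ℝ x (EuclideanSpace.single 0 (1 : ℝ)))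
    {a b : EuclideanSpace ℝ (Fin (2 + m))} (ha : IsInnerNormalAt (symmSet μ) (joinXZ y z) a)
    (hb : IsInnerNormalAt (symmSet μ) (joinXZ x z) b) (hne : x ≠ y) :
    inner ℝ (hat x) (xPart b) = inner ℝ (hat y) (xPart a) ∧
      ‖tangential x b‖ = ‖tangential y a‖ ∧ zPart b = zPart a := by
  have hO := reflectX_sub_joinXZ h hne z
  have hab := IsInnerNormalAt.map_eq_of_eventually_mapsTo hF (reflectX m (y - x)) hO
    (eventually_reflectX_mem_symmSet μ h hne hle z) ha hb
  have hrad : inner ℝ (hat x) (xPart b) = inner ℝ (hat y) (xPart a) := by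
    have e : ∀ (u : EuclideanSpace ℝ (Fin 2)) (v : EuclideanSpace ℝ (Fin (2 + m))),
        inner ℝ u (xPart v) = inner ℝ (joinXZ u 0) v := fun u v => by
      rw [inner_eq_xPart_add_zPart, xPart_joinXZ, zPart_joinXZ, inner_zero_left, add_zero]
    rw [hat, hat, real_inner_smul_left, real_inner_smul_left, h, e, e, ← hab,
      ← reflectX_sub_joinXZ h hne 0, LinearIsometryEquiv.inner_map_map]
  refine ⟨hrad, ?_, by rw [← hab, zPart_reflectX]⟩
  refine (pow_left_inj₀ (norm_nonneg _) (norm_nonneg _) two_ne_zero).1 ?_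
  rw [norm_tangential_sq hx0, norm_tangential_sq hy0, hrad, ← hab, norm_xPart_reflectX]

theorem circular_components_innerNormal_eq {μ : ℝ × EuclideanSpace ℝ (Fin m) → ℝ}
    (hF : NullMeasurableSet (symmSet μ) volume) {r : ℝ} {z : EuclideanSpace ℝ (Fin m)}
    {x y : EuclideanSpace ℝ (Fin 2)} (hx : x ∈ slice (reducedBoundary (symmSet μ)) r z)
    (hy : y ∈ slice (reducedBoundary (symmSet μ)) r z) :
    inner ℝ (hat x) (xPart (innerNormal (symmSet μ) (joinXZ x z))) =
        inner ℝ (hat y) (xPart (innerNormal (symmSet μ) (joinXZ y z))) ∧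
      ‖tangential x (innerNormal (symmSet μ) (joinXZ x z))‖ =
        ‖tangential y (innerNormal (symmSet μ) (joinXZ y z))‖ ∧
      zPart (innerNormal (symmSet μ) (joinXZ x z)) =
        zPart (innerNormal (symmSet μ) (joinXZ y z)) := by
  obtain rfl | hne := eq_or_ne x y
  · exact ⟨rfl, rfl, rfl⟩
  have hxν := isInnerNormalAt_innerNormal hx.2.2
  have hyν := isInnerNormalAt_innerNormal hy.2.2
  have hn : ‖x‖ = ‖y‖ := hx.2.1.trans hy.2.1.symm
  rcases le_total (inner ℝ y (EuclideanSpace.single 0 1))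
    (inner ℝ x (EuclideanSpace.single 0 (1 : ℝ))) with hle | hle
  · exact circular_components_eq_of_inner_le hF hx.1 hy.1 hn hle hyν hxν hne
  · obtain ⟨h1, h2, h3⟩ :=
      circular_components_eq_of_inner_le hF hy.1 hx.1 hn.symm hle hxν hyν hne.symm
    exact ⟨h1.symm, h2.symm, h3.symm⟩

end CircularSymm

theorem proposition1p1 (m : ℕ) (μ : ℝ × EuclideanSpace ℝ (Fin m) → ℝ)
    (hμ_meas : AEMeasurable μ (volume.restrict (halfSpace m)))
    (hμ_nonneg : ∀ p ∈ halfSpace m, 0 ≤ μ p)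
    (hμ_le : ∀ᵐ p ∂(volume.restrict (halfSpace m)), μ p ≤ 2 * Real.pi * p.1)
    (hF : LocallyFinitePerimeter (symmSet μ))
    (r : ℝ) (hr : 0 < r) (z : EuclideanSpace ℝ (Fin m))
    (hne : (slice (reducedBoundary (symmSet μ)) r z).Nonempty) :
    (∃ a : ℝ, ∀ x ∈ slice (reducedBoundary (symmSet μ)) r z,
      inner ℝ (hat x) (xPart (innerNormal (symmSet μ) (joinXZ x z))) = a) ∧
    (∃ b : ℝ, ∀ x ∈ slice (reducedBoundary (symmSet μ)) r z,
      ‖tangential x (innerNormal (symmSet μ) (joinXZ x z))‖ = b) ∧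
    (∃ w : EuclideanSpace ℝ (Fin m), ∀ x ∈ slice (reducedBoundary (symmSet μ)) r z,
      zPart (innerNormal (symmSet μ) (joinXZ x z)) = w) ∧
    (∃ c : EuclideanSpace ℝ (Fin (2 + m)), ∀ x ∈ slice (reducedBoundary (symmSet μ)) r z,
      circularNormal (symmSet μ) x z = c) := by
  obtain ⟨x₀, hx₀⟩ := hne
  have key := fun x (hx : x ∈ slice (reducedBoundary (symmSet μ)) r z) =>
    circular_components_innerNormal_eq hF.nullMeasurableSet hx hx₀
  refine ⟨⟨_, fun x hx => (key x hx).1⟩, ⟨_, fun x hx => (key x hx).2.1⟩,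
    ⟨_, fun x hx => (key x hx).2.2⟩, circularNormal (symmSet μ) x₀ z, fun x hx => ?_⟩
  obtain ⟨h1, h2, h3⟩ := key x hx
  rw [circularNormal, circularNormal, h1, h2, h3]
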